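/- Let $F$ be a field and let $V$ be a nonzero $F$-vector space of finite dimension $d\ge 1$. Let $\mathcal{T}_V$ be the Tits building of $V$, i.e. the simplicial complex whose $p$-simplices are the flags $W_0\subsetneq W_1\subsetneq\dots\subsetneq W_p$ of nonzero proper subspaces of $V$, and let \[ \mathrm{St}(V)=\widetilde{H}_{d-2}(\mathcal{T}_V;\mathbb{Q}) \] be the rational Steinberg module: its top reduced simplicial homology group, with the natural action of $\mathrm{GL}(V)$. (By convention the reduced homology of the empty complex is $\mathbb{Q}$ in degree $-1$, so $\mathrm{St}(V)\cong\mathbb{Q}$ when $d=1$.) Let $\mathrm{GL}(V)$ act diagonally on $\mathrm{St}(V)\otimes_{\mathbb{Q}}\mathrm{St}(V)$. Then the space of coinvariants is one-dimensional: there is an isomorphism of $\mathbb{Q}$-vector spaces \[ H_0\bigl(\mathrm{GL}(V),\ \mathrm{St}(V)\otimes_{\mathbb{Q}}\mathrm{St}(V)\bigr)=\bigl(\mathrm{St}(V)\otimes_{\mathbb{Q}}\mathrm{St}(V)\bigr)_{\mathrm{GL}(V)}\cong\mathbb{Q}. \] -/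

import Mathlib

noncomputable section

namespace SteinbergModule

/-! ### Reduced rational simplicial homology of the order complex of a poset -/

/-- A flag with `k` members in a poset `P`: a strictly increasing chain `x₀ < x₁ < ⋯ < x_{k-1}`,
that is, a `(k-1)`-simplex of the order complex of `P`; for `k = 0`, the empty simplex. -/
abbrev Flag (P : Type*) [PartialOrder P] (k : ℕ) : Type _ := Fin k ↪o P

/-- The `i`-th face of a flag: omit its `i`-th member. -/
def Flag.face {P : Type*} [PartialOrder P] {k : ℕ} (i : Fin (k + 1)) (s : Flag P (k + 1)) :
    Flag P k :=
  (Fin.succAboveOrderEmb i).trans s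

/-- The image of a flag under an order embedding of posets. -/
def Flag.map {P Q : Type*} [PartialOrder P] [PartialOrder Q] (e : P ↪o Q) {k : ℕ}
    (s : Flag P k) : Flag Q k :=
  s.trans e

/-- The augmented rational simplicial chains of the order complex of `P`, indexed by the number of
vertices: `Chains P k` is the space of chains of degree `k - 1`. In particular `Chains P 0` is a
copy of `ℚ`, spanned by the empty simplex, in degree `-1`. -/
abbrev Chains (P : Type*) [PartialOrder P] (k : ℕ) : Type _ := Flag P k →₀ ℚ

/-- The simplicial boundary `∂ s = ∑ i, (-1)^i • (i-th face of s)`; for `k = 0` it is the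
augmentation. -/
def boundary (P : Type*) [PartialOrder P] (k : ℕ) : Chains P (k + 1) →ₗ[ℚ] Chains P k :=
  ∑ i : Fin (k + 1), (-1 : ℚ) ^ (i : ℕ) • Finsupp.lmapDomain ℚ ℚ (Flag.face i)

/-- Cycles among the chains on flags with `k` members (all chains if `k = 0`). -/
def cycles (P : Type*) [PartialOrder P] : (k : ℕ) → Submodule ℚ (Chains P k)
  | 0 => ⊤
  | k + 1 => LinearMap.ker (boundary P k)

/-- Boundaries among the chains on flags with `k` members. -/
def boundaries (P : Type*) [PartialOrder P] (k : ℕ) : Submodule ℚ (Chains P k) :=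
  LinearMap.range (boundary P k)

theorem boundary_single (P : Type*) [PartialOrder P] (k : ℕ) (s : Flag P (k + 1)) (a : ℚ) :
    boundary P k (Finsupp.single s a) =
      ∑ i : Fin (k + 1), (-1 : ℚ) ^ (i : ℕ) • Finsupp.single (s.face i) a := by
  simp [boundary, LinearMap.sum_apply]

theorem boundary_boundary (P : Type*) [PartialOrder P] (k : ℕ) (x : Chains P (k + 2)) :
    boundary P k (boundary P (k + 1) x) = 0 := by
  induction x using Finsupp.induction_linear with
  | zero => simp
  | add x y hx hy => simp [hx, hy]
  | single s a =>
    simp only [boundary_single, map_sum, map_smul, Finset.smul_sum, smul_smul]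
    rw [Finset.sum_sigma']
    refine Finset.sum_involution (fun p _ => ⟨p.1.succAbove p.2, p.2.predAbove p.1⟩) ?_ ?_ ?_ ?_
    · rintro ⟨i, j⟩ -
      have hface : (s.face (i.succAbove j)).face (j.predAbove i) = (s.face i).face j :=
        RelEmbedding.ext fun m =>
          congrArg s (Fin.succAbove_succAbove_succAbove_predAbove i j m)
      have hsign : (-1 : ℚ) ^ ((i.succAbove j : Fin (k + 2)) : ℕ) *
          (-1) ^ ((j.predAbove i : Fin (k + 1)) : ℕ) = -((-1) ^ (i : ℕ) * (-1) ^ (j : ℕ)) := by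
        rw [← pow_add, Fin.neg_one_pow_succAbove_add_predAbove, pow_add]
      simp only [hface, hsign, neg_smul, add_neg_cancel]
    · rintro ⟨i, j⟩ - - h
      exact Fin.succAbove_ne i j (congrArg Sigma.fst h)
    · exact fun _ _ => Finset.mem_univ _
    · rintro ⟨i, j⟩ -
      exact Sigma.ext (Fin.succAbove_succAbove_predAbove i j)
        (heq_of_eq (Fin.predAbove_predAbove_succAbove i j))

theorem boundaries_le_cycles (P : Type*) [PartialOrder P] (k : ℕ) :
    boundaries P k ≤ cycles P k := by
  cases k with
  | zero => exact le_top
  | succ k =>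
    rintro _ ⟨x, rfl⟩
    exact boundary_boundary P k x

/-- The reduced simplicial homology `H̃_{k-1}` with rational coefficients of the order complex of
`P`: cycles modulo boundaries. For `k = 0` this is `H̃_{-1}`, which is `ℚ` if `P` is empty. -/
abbrev ReducedHomology (P : Type*) [PartialOrder P] (k : ℕ) : Type _ :=
  cycles P k ⧸ (boundaries P k).comap (cycles P k).subtype

/-! ### Functoriality in the poset -/

/-- The chain map induced by an order embedding. -/
def chainsMap {P Q : Type*} [PartialOrder P] [PartialOrder Q] (e : P ↪o Q) (k : ℕ) :
    Chains P k →ₗ[ℚ] Chains Q k :=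
  Finsupp.lmapDomain ℚ ℚ (Flag.map e)

theorem chainsMap_single {P Q : Type*} [PartialOrder P] [PartialOrder Q] (e : P ↪o Q) (k : ℕ)
    (s : Flag P k) (a : ℚ) :
    chainsMap e k (Finsupp.single s a) = Finsupp.single (s.map e) a :=
  Finsupp.mapDomain_single

theorem boundary_chainsMap {P Q : Type*} [PartialOrder P] [PartialOrder Q] (e : P ↪o Q) (k : ℕ)
    (x : Chains P (k + 1)) :
    boundary Q k (chainsMap e (k + 1) x) = chainsMap e k (boundary P k x) := by
  induction x using Finsupp.induction_linear with
  | zero => simp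
  | add x y hx hy => simp [hx, hy]
  | single s a =>
    simp only [chainsMap_single, boundary_single, map_sum, map_smul]
    rfl

theorem chainsMap_mem_cycles {P Q : Type*} [PartialOrder P] [PartialOrder Q] (e : P ↪o Q) (k : ℕ) :
    ∀ x ∈ cycles P k, chainsMap e k x ∈ cycles Q k := by
  cases k with
  | zero => exact fun _ _ => Submodule.mem_top
  | succ k =>
    intro x hx
    have hx' : boundary P k x = 0 := hx
    change boundary Q k (chainsMap e (k + 1) x) = 0
    rw [boundary_chainsMap, hx', map_zero]

theorem chainsMap_mem_boundaries {P Q : Type*} [PartialOrder P] [PartialOrder Q] (e : P ↪o Q)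
    (k : ℕ) : ∀ x ∈ boundaries P k, chainsMap e k x ∈ boundaries Q k := by
  rintro _ ⟨x, rfl⟩
  exact ⟨chainsMap e (k + 1) x, boundary_chainsMap e k x⟩

/-- The map on reduced homology induced by an order embedding. -/
def homologyMap {P Q : Type*} [PartialOrder P] [PartialOrder Q] (e : P ↪o Q) (k : ℕ) :
    ReducedHomology P k →ₗ[ℚ] ReducedHomology Q k :=
  Submodule.mapQ _ _ ((chainsMap e k).restrict (chainsMap_mem_cycles e k))
    fun x hx => chainsMap_mem_boundaries e k x hx

theorem homologyMap_id {P : Type*} [PartialOrder P] (e : P ↪o P) (he : ∀ x, e x = x) (k : ℕ) :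
    homologyMap e k = 1 := by
  obtain rfl : e = RelEmbedding.refl _ := RelEmbedding.ext he
  refine LinearMap.ext fun x => ?_
  obtain ⟨x, rfl⟩ := Submodule.Quotient.mk_surjective _ x
  refine congrArg _ (Subtype.ext ?_)
  exact DFunLike.congr_fun (Finsupp.lmapDomain_id ℚ ℚ) (x : Chains P k)

theorem homologyMap_comp {P Q R : Type*} [PartialOrder P] [PartialOrder Q] [PartialOrder R]
    (f : P ↪o Q) (g : Q ↪o R) (h : P ↪o R) (hh : ∀ x, h x = g (f x)) (k : ℕ) :
    homologyMap h k = homologyMap g k ∘ₗ homologyMap f k := by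
  obtain rfl : h = f.trans g := RelEmbedding.ext hh
  refine LinearMap.ext fun x => ?_
  obtain ⟨x, rfl⟩ := Submodule.Quotient.mk_surjective _ x
  refine congrArg _ (Subtype.ext ?_)
  exact DFunLike.congr_fun (Finsupp.lmapDomain_comp ℚ ℚ (Flag.map f) (Flag.map g))
    (x : Chains P k)

/-! ### The Tits building and the Steinberg module -/

/-- The poset of nonzero proper subspaces of `V`, ordered by inclusion; its order complex is the
Tits building of `V`. -/
abbrev ProperSubspace (F V : Type*) [Field F] [AddCommGroup V] [Module F V] : Type _ :=
  {W : Submodule F V // W ≠ ⊥ ∧ W ≠ ⊤}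

/-- An element `g` of `GL(V)` acts on the nonzero proper subspaces by `W ↦ g(W)`. -/
def subspaceMap {F V : Type*} [Field F] [AddCommGroup V] [Module F V]
    (g : LinearMap.GeneralLinearGroup F V) : ProperSubspace F V ↪o ProperSubspace F V where
  toFun W := ⟨W.1.map (LinearMap.GeneralLinearGroup.toLinearEquiv g : V →ₗ[F] V), by
    refine ⟨fun h => W.2.1 ?_, fun h => W.2.2 ?_⟩
    · simpa using h
    · simpa using h⟩
  inj' W W' h := Subtype.ext <|
    Submodule.map_injective_of_injective
      (LinearMap.GeneralLinearGroup.toLinearEquiv g).injective (congrArg Subtype.val h)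
  map_rel_iff' {W W'} :=
    Submodule.map_le_map_iff_of_injective
      (LinearMap.GeneralLinearGroup.toLinearEquiv g).injective W.1 W'.1

/-- The rational Steinberg module `St(V) = H̃_{d-2}(T_V; ℚ)`, `d = dim V`, where `T_V` is the Tits
building. Simplices of dimension `d - 2` have `d - 1` vertices. -/
abbrev St (F V : Type*) [Field F] [AddCommGroup V] [Module F V] : Type _ :=
  ReducedHomology (ProperSubspace F V) (Module.finrank F V - 1)

/-- The natural action of `GL(V)` on `St(V)`. -/
def stRep (F V : Type*) [Field F] [AddCommGroup V] [Module F V] :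
    Representation ℚ (LinearMap.GeneralLinearGroup F V) (St F V) where
  toFun g := homologyMap (subspaceMap g) _
  map_one' := homologyMap_id _ (fun W => Subtype.ext (Submodule.map_id W.1)) _
  map_mul' g h := homologyMap_comp (subspaceMap h) (subspaceMap g) _
    (fun W => Subtype.ext (Submodule.map_comp _ _ W.1)) _

/-- The tensor square `St(V) ⊗ St(V)` over `ℚ`, with the diagonal action of `GL(V)`. -/
def stSquareRep (F V : Type*) [Field F] [AddCommGroup V] [Module F V] :
    Representation ℚ (LinearMap.GeneralLinearGroup F V) (TensorProduct ℚ (St F V) (St F V)) :=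
  (stRep F V).tprod (stRep F V)

end SteinbergModule

end

/-! Lower bound. The bilinear form on chains for which the flags are orthonormal is invariant under
`GL(V)`. In the top degree there are no boundaries, so it induces an invariant pairing on `St(V)`.
Being positive definite, it is nonzero at `[b] ⊗ [b]` for the apartment class `[b]` of any basis
(`stPairing_aptPair_self_ne_zero`), so the coinvariants are nonzero.

Upper bound. By the Solomon–Tits theorem (`flagCycles_le_aptSpan`) apartment classes span `St(V)`,
so the coinvariants are spanned by the classes of `[e] ⊗ [e']`. The diagonal ones all coincide,
because `GL(V)` is transitive on bases. It remains to see that every pair vanishes modulo the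
diagonal (`IsInvariantForm.eq_zero`); this uses only invariance and the formal relations of modular
symbols in each variable.

The proof is by induction on the dimension. If `e` and `e'` respect a common decomposition of the
space, the induction hypothesis, applied to one summand at a time, reduces to the diagonal. In
general, expand both bases along a vector `x`, so that both contain it. The remaining vectors span
two complements of `x`. If these agree, the pair splits. If not, further expansions put all vectors
but one of each basis into the intersection of the complements, and after scaling the exceptional
vectors satisfy `e' j = x + e j + u` with `u` in the intersection. The procedure then restarts
inside the intersection with `u` in place of `x`; each round disposes of two vectors. `IsSumPair` is
the invariant of this descent.

Passing to the next round rests on `IsInvariantForm.eq_zero_of_update_sum`: a vanishing value is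
expanded along `x` in both variables, the diagonal terms vanish because they split, and the others
are equal by symmetry. So a positive multiple of the desired value is zero, and rational
coefficients finish. -/

noncomputable section

namespace SteinbergModule

open Function

section ModularSymbols

variable {F X C ι : Type*} [Field F] [AddCommGroup X] [Module F X] [AddCommGroup C]

/-! ### Spans of subfamilies -/

/-- The span of the members of the family `e` indexed by `J`. -/
abbrev spanOn (F : Type*) {X ι : Type*} [Field F] [AddCommGroup X] [Module F X] (e : ι → X)
    (J : Finset ι) : Submodule F X :=
  Submodule.span F (e '' J)

theorem mem_spanOn (e : ι → X) {J : Finset ι} {i : ι} (hi : i ∈ J) : e i ∈ spanOn F e J :=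
  Submodule.subset_span ⟨i, hi, rfl⟩

theorem spanOn_le {e : ι → X} {J : Finset ι} {W : Submodule F X} (h : ∀ i ∈ J, e i ∈ W) :
    spanOn F e J ≤ W := by
  rw [Submodule.span_le]
  rintro _ ⟨i, hi, rfl⟩
  exact h i hi

theorem finrank_spanOn {e : ι → X} (he : LinearIndependent F e) (J : Finset ι) :
    Module.finrank F (spanOn F e J) = J.card := by
  have h := finrank_span_eq_card (he.comp ((↑) : J → ι) Subtype.val_injective)
  rw [Set.range_comp, Subtype.range_coe_subtype, Fintype.card_coe] at h
  exact h

theorem spanOn_eq [FiniteDimensional F X] {e e' : ι → X} (he : LinearIndependent F e)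
    (he' : LinearIndependent F e') {J : Finset ι} (h : ∀ i ∈ J, e' i ∈ spanOn F e J) :
    spanOn F e' J = spanOn F e J :=
  Submodule.eq_of_le_of_finrank_eq (spanOn_le h) (by
    rw [finrank_spanOn he, finrank_spanOn he'])

theorem spanOn_mono (e : ι → X) {J K : Finset ι} (h : J ⊆ K) : spanOn F e J ≤ spanOn F e K :=
  Submodule.span_mono (Set.image_mono (by exact_mod_cast h))

theorem mem_spanOn_iff [Fintype ι] {e : ι → X} {J : Finset ι} {x : X} :
    x ∈ spanOn F e J ↔ ∃ c : ι → F, (∀ i ∉ J, c i = 0) ∧ x = ∑ i, c i • e i := by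
  classical
  constructor
  · intro h
    induction h using Submodule.span_induction with
    | mem x hx =>
      obtain ⟨i, hi, rfl⟩ := hx
      refine ⟨Pi.single i 1, fun t ht => Pi.single_eq_of_ne (by rintro rfl; exact ht hi) _, ?_⟩
      rw [Finset.sum_eq_single i (fun t _ ht => by simp [ht]) (by simp)]
      simp
    | zero => exact ⟨0, by simp, by simp⟩
    | add x y _ _ hx hy =>
      obtain ⟨c, hc, rfl⟩ := hx
      obtain ⟨b, hb, rfl⟩ := hy
      exact ⟨c + b, fun i hi => by simp [hc i hi, hb i hi], by
        simp [add_smul, Finset.sum_add_distrib]⟩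
    | smul a x _ hx =>
      obtain ⟨c, hc, rfl⟩ := hx
      exact ⟨a • c, fun i hi => by simp [hc i hi], by simp [Finset.smul_sum, smul_smul]⟩
  · rintro ⟨c, hc, rfl⟩
    refine Submodule.sum_mem _ fun i _ => ?_
    by_cases hi : i ∈ J
    · exact Submodule.smul_mem _ _ (mem_spanOn e hi)
    · simp [hc i hi]

theorem linearIndependent_of_mem_span [Fintype ι] [FiniteDimensional F X]
    (hc : Fintype.card ι = Module.finrank F X)
    {e v : ι → X} (he : LinearIndependent F e)
    (h : ∀ i, e i ∈ Submodule.span F (Set.range v)) : LinearIndependent F v := by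
  refine linearIndependent_of_top_le_span_of_card_eq_finrank ?_ hc
  rw [← he.span_eq_top_of_card_eq_finrank' hc, Submodule.span_le]
  rintro _ ⟨i, rfl⟩
  exact h i

theorem linearIndependent_update [Fintype ι] [FiniteDimensional F X] [DecidableEq ι]
    (hc : Fintype.card ι = Module.finrank F X)
    {e : ι → X} (he : LinearIndependent F e) {J : Finset ι} {x : X} {c : ι → F}
    (hx : x = ∑ i ∈ J, c i • e i) {i : ι} (hiJ : i ∈ J) (hi : c i ≠ 0) :
    LinearIndependent F (update e i x) := by
  refine linearIndependent_of_mem_span hc he fun t => ?_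
  have hmem : ∀ t, t ≠ i → e t ∈ Submodule.span F (Set.range (update e i x)) := fun t ht =>
    Submodule.subset_span ⟨t, by simp [ht]⟩
  by_cases ht : t = i
  · subst ht
    have h1 : x ∈ Submodule.span F (Set.range (update e t x)) := Submodule.subset_span ⟨t, by simp⟩
    have h2 : e t = (c t)⁻¹ • (x - ∑ s ∈ J.erase t, c s • e s) := by
      rw [hx, ← Finset.add_sum_erase _ _ hiJ, add_sub_cancel_right, smul_smul,
        inv_mul_cancel₀ hi, one_smul]
    rw [h2]
    exact Submodule.smul_mem _ _ (Submodule.sub_mem _ h1 (Submodule.sum_mem _ fun s hs =>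
      Submodule.smul_mem _ _ (hmem s (Finset.ne_of_mem_erase hs))))
  · exact hmem t ht

theorem spanOn_update [DecidableEq ι] [FiniteDimensional F X]
    {e : ι → X} (he : LinearIndependent F e) {J : Finset ι} {x : X} (hx : x ∈ spanOn F e J) {i : ι}
    (hi : LinearIndependent F (update e i x)) :
    spanOn F (update e i x) J = spanOn F e J := by
  refine spanOn_eq he hi fun t ht => ?_
  by_cases hti : t = i
  · subst hti; simpa using hx
  · rw [update_of_ne hti]; exact mem_spanOn e ht

/-! ### Modular symbols -/

/-- A function on bases with the formal properties of apartment classes: it is insensitive to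
scaling of the basis vectors, alternating, and satisfies the relation that expands a basis as a
sum of bases that contain a given nonzero vector. -/
structure IsModularSymbol (F : Type*) {X C ι : Type*} [Field F] [AddCommGroup X] [Module F X]
    [AddCommGroup C] [Fintype ι] [DecidableEq ι] (φ : (ι → X) → C) : Prop where
  smul : ∀ v, LinearIndependent F v → ∀ a : ι → F, (∀ i, a i ≠ 0) →
    φ (fun i => a i • v i) = φ v
  perm : ∀ v, LinearIndependent F v → ∀ σ : Equiv.Perm ι,
    φ (v ∘ σ) = (Equiv.Perm.sign σ : ℤ) • φ v
  rel : ∀ v, LinearIndependent F v → ∀ (J : Finset ι) (c : ι → F) (x : X), J.Nonempty →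
    (∀ i ∈ J, c i ≠ 0) → x = ∑ i ∈ J, c i • v i → φ v = ∑ i ∈ J, φ (update v i x)

/-- A form on pairs of bases that is a modular symbol in both variables and invariant under the
general linear group. -/
structure IsInvariantForm (F : Type*) {X C ι : Type*} [Field F] [AddCommGroup X] [Module F X]
    [AddCommGroup C] [Fintype ι] [DecidableEq ι] (Φ : (ι → X) → (ι → X) → C) : Prop where
  left : ∀ e', LinearIndependent F e' → IsModularSymbol F (fun e => Φ e e')
  right : ∀ e, LinearIndependent F e → IsModularSymbol F (fun e' => Φ e e')
  inv : ∀ (g : X ≃ₗ[F] X) (e e' : ι → X), LinearIndependent F e → LinearIndependent F e' →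
    Φ (g ∘ e) (g ∘ e') = Φ e e'

variable [Fintype ι] [DecidableEq ι] [FiniteDimensional F X]

/-- The relation is applied to the members whose coefficient in `x` is nonzero. They lie in `J`, and
replacing any one of them by `x` gives a basis again. -/
theorem IsModularSymbol.eq_zero_of_update {φ : (ι → X) → C} (hφ : IsModularSymbol F φ)
    (hc : Fintype.card ι = Module.finrank F X) {e : ι → X} (he : LinearIndependent F e)
    {J : Finset ι} {x : X} (hx : x ∈ spanOn F e J) (hx0 : x ≠ 0)
    (h : ∀ i ∈ J, LinearIndependent F (update e i x) → φ (update e i x) = 0) : φ e = 0 := by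
  classical
  obtain ⟨c, hcJ, hcx⟩ := mem_spanOn_iff.1 hx
  have hcx' : x = ∑ i with c i ≠ 0, c i • e i := by
    rw [hcx, Finset.sum_filter]
    exact Finset.sum_congr rfl fun i _ => by by_cases h : c i = 0 <;> simp [h]
  rw [hφ.rel e he _ c x (Finset.nonempty_of_sum_ne_zero (hcx' ▸ hx0))
    (fun i hi => (Finset.mem_filter.1 hi).2) hcx']
  refine Finset.sum_eq_zero fun i hi => ?_
  have hi' := (Finset.mem_filter.1 hi).2
  exact h i (by_contra fun hJ => hi' (hcJ i hJ)) (linearIndependent_update hc he hcx' hi hi')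

/-- A modular symbol vanishes at a basis if it vanishes at all bases whose members indexed by `J`
span the same subspace and lie, with one exception, in the kernel of a given functional. -/
theorem IsModularSymbol.eq_zero_of_hyperplane {φ : (ι → X) → C} (hφ : IsModularSymbol F φ)
    (hc : Fintype.card ι = Module.finrank F X) {J : Finset ι} (hJ : J.Nonempty) (f : X →ₗ[F] F)
    {e : ι → X} (he : LinearIndependent F e)
    (h : ∀ v, LinearIndependent F v → (∀ i ∉ J, v i = e i) → (∀ i ∈ J, v i ∈ spanOn F e J) →
      (∃ j ∈ J, ∀ i ∈ J, i ≠ j → f (v i) = 0) → φ v = 0) : φ e = 0 := by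
  classical
  -- The induction is on the number of members in `J` that lie outside `ker f`.
  induction hn : (J.filter fun i => f (e i) ≠ 0).card using Nat.strong_induction_on
    generalizing e with
  | _ n ih =>
  subst hn
  by_cases hone : ∃ j ∈ J, ∀ i ∈ J, i ≠ j → f (e i) = 0
  · exact h e he (fun _ _ => rfl) (fun i hi => mem_spanOn e hi) hone
  push Not at hone
  obtain ⟨j₀, hj₀⟩ := hJ
  obtain ⟨a, ha, -, hfa⟩ := hone j₀ hj₀
  obtain ⟨b, hb, hab, hfb⟩ := hone a ha
  -- Two members outside `ker f` have a combination `u` inside it. Each term of the expansion along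
  -- `u` replaces one of the two, which lowers the count.
  set u : X := e a - (f (e a) / f (e b)) • e b with hu
  have hfu : f u = 0 := by simp [hu, hfb]
  set c : ι → F := fun t => if t = a then 1 else -(f (e a) / f (e b)) with hcdef
  have hcu : u = ∑ i ∈ {a, b}, c i • e i := by
    rw [Finset.sum_pair hab.symm]
    simp [hcdef, hab, hu, sub_eq_add_neg]
  have hcab : ∀ i ∈ ({a, b} : Finset ι), c i ≠ 0 := by
    simp [hcdef, hab, hfa, hfb]
  have huJ : u ∈ spanOn F e J := Submodule.sub_mem _ (mem_spanOn e ha)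
    (Submodule.smul_mem _ _ (mem_spanOn e hb))
  rw [hφ.rel e he {a, b} c u (by simp) hcab hcu]
  refine Finset.sum_eq_zero fun i hi => ?_
  have hli := linearIndependent_update hc he hcu hi (hcab i hi)
  have hiab : i = a ∨ i = b := by simpa using hi
  have hiJ : i ∈ J := by rcases hiab with rfl | rfl <;> assumption
  have hfi : f (e i) ≠ 0 := by rcases hiab with rfl | rfl <;> assumption
  refine ih _ ?_ hli (fun v hv hvJ hvs hve => h v hv (fun t ht => ?_) (fun t ht => ?_) hve) rfl
  · refine Finset.card_lt_card (Finset.ssubset_iff_of_subset ?_ |>.2 ⟨i, by simp [hiJ, hfi], ?_⟩)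
    · intro t ht
      rw [Finset.mem_filter] at ht ⊢
      refine ⟨ht.1, fun h0 => ht.2 ?_⟩
      by_cases hti : t = i
      · subst hti; simpa using hfu
      · rwa [update_of_ne hti]
    · simp [hfu]
  · rw [hvJ t ht, update_of_ne (by rintro rfl; exact ht hiJ)]
  · rw [← spanOn_update he huJ hli]; exact hvs t ht

end ModularSymbols

/-! ### Pairs of bases compatible with a decomposition, and the symmetry argument -/

section SplitPairs

variable {F X C ι : Type*} [Field F] [AddCommGroup X] [Module F X] [AddCommGroup C]
variable [Fintype ι] [DecidableEq ι] [FiniteDimensional F X]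

/-- The form `Φ` vanishes at each pair of bases that are compatible with a common decomposition
of the space as a direct sum of two nonzero subspaces. -/
def VanishesOnSplit (F : Type*) {X C ι : Type*} [Field F] [AddCommGroup X] [Module F X]
    [AddCommGroup C] [Fintype ι] [DecidableEq ι] (Φ : (ι → X) → (ι → X) → C) : Prop :=
  ∀ e e', LinearIndependent F e → LinearIndependent F e' → ∀ J : Finset ι, J.Nonempty →
    Jᶜ.Nonempty → (∀ i ∈ J, e' i ∈ spanOn F e J) → (∀ i ∉ J, e' i ∈ spanOn F e Jᶜ) → Φ e e' = 0

omit [DecidableEq ι] in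
theorem linearIndependent_smul_of_ne_zero (hc : Fintype.card ι = Module.finrank F X)
    {e : ι → X} (he : LinearIndependent F e) {a : ι → F} (ha : ∀ i, a i ≠ 0) :
    LinearIndependent F (fun i => a i • e i) :=
  linearIndependent_of_mem_span hc he fun i => by
    have : e i = (a i)⁻¹ • (a i • e i) := by rw [smul_smul, inv_mul_cancel₀ (ha i), one_smul]
    rw [this]
    exact Submodule.smul_mem _ _ (Submodule.subset_span ⟨i, rfl⟩)

-- The decomposition is given by `J.erase i` and its complement. The complement contains `i`, so
-- multiples of `e i` in the members outside `J` do no harm.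
omit [FiniteDimensional F X] in
theorem VanishesOnSplit.eq_zero_of_common {Φ : (ι → X) → (ι → X) → C} (hΦ : VanishesOnSplit F Φ)
    {e e' : ι → X} (he : LinearIndependent F e) (he' : LinearIndependent F e')
    {J : Finset ι} {i : ι} (hi : i ∈ J) (hne : (J.erase i).Nonempty)
    (hei : e' i = e i)
    (hJ : ∀ t ∈ J.erase i, e' t ∈ spanOn F e (J.erase i))
    (hoff : ∀ t ∉ J, e' t ∈ spanOn F e Jᶜ ⊔ Submodule.span F {e i}) : Φ e e' = 0 := by
  refine hΦ e e' he he' (J.erase i) hne ⟨i, by simp⟩ hJ fun t ht => ?_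
  have hii : i ∈ (J.erase i)ᶜ := by simp
  by_cases hti : t = i
  · subst hti
    rw [hei]
    exact mem_spanOn e hii
  · have htJ : t ∉ J := fun h => ht (Finset.mem_erase.2 ⟨hti, h⟩)
    refine (sup_le (spanOn_mono e ?_) ?_ : spanOn F e Jᶜ ⊔ Submodule.span F {e i} ≤ _) (hoff t htJ)
    · exact Finset.compl_subset_compl.2 (Finset.erase_subset _ _)
    · rw [Submodule.span_singleton_le_iff_mem]
      exact mem_spanOn e hii

/-- If `x` is the sum of the members of `c` indexed by `J`, and `c'` has the same members there,
then the values of an invariant form at the pairs obtained by replacing two different members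
by `x` are all equal. -/
theorem IsInvariantForm.update_update_eq {Φ : (ι → X) → (ι → X) → C} (hΦ : IsInvariantForm F Φ)
    (hc : Fintype.card ι = Module.finrank F X)
    {c c' : ι → X} (hcl : LinearIndependent F c) (hcl' : LinearIndependent F c')
    {J : Finset ι} {x : X} (hx : x = ∑ t ∈ J, c t) (hcc : ∀ t ∈ J, c' t = c t)
    (hoff : ∀ t ∉ J, c' t ∈ spanOn F c Jᶜ ⊔ Submodule.span F {x})
    {i j a b : ι} (hi : i ∈ J) (hj : j ∈ J) (ha : a ∈ J) (hb : b ∈ J) (hij : i ≠ j) (hab : a ≠ b) :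
    Φ (update c a x) (update c' b x) = Φ (update c i x) (update c' j x) := by
  have : Nonempty ι := ⟨i⟩
  have hx' : x = ∑ t ∈ J, c' t := hx.trans (Finset.sum_congr rfl fun t ht => (hcc t ht).symm)
  have hlic : ∀ t ∈ J, LinearIndependent F (update c t x) := fun t ht =>
    linearIndependent_update hc hcl (c := 1) (by simpa using hx) ht (by simp)
  have hlic' : ∀ t ∈ J, LinearIndependent F (update c' t x) := fun t ht =>
    linearIndependent_update hc hcl' (c := 1) (by simpa using hx') ht (by simp)
  -- Permuting the basis `c` by a permutation `π` of `J` with `a ↦ i` and `b ↦ j` defines an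
  -- automorphism. It fixes the sum `x` and the members of `c` outside `J`, hence also those of
  -- `c'`.
  obtain ⟨π, hπa, hπb, hπ, hπJ⟩ : ∃ π : Equiv.Perm ι, π a = i ∧ π b = j ∧ (∀ t ∉ J, π t = t) ∧
      ∀ t ∈ J, π t ∈ J := by
    have hs : ∀ p ∈ J, ∀ q ∈ J, ∀ t ∈ J, Equiv.swap p q t ∈ J := by
      intro p hp q hq t ht
      rw [Equiv.swap_apply_def]
      split_ifs <;> assumption
    have hib : Equiv.swap a i b ≠ i := fun h => hab (by
      have := (Equiv.swap a i).injective (h.trans (Equiv.swap_apply_left a i).symm)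
      exact this.symm)
    refine ⟨Equiv.swap (Equiv.swap a i b) j * Equiv.swap a i, ?_, ?_, ?_, ?_⟩
    · rw [Equiv.Perm.mul_apply, Equiv.swap_apply_left, Equiv.swap_apply_of_ne_of_ne hib.symm hij]
    · rw [Equiv.Perm.mul_apply, Equiv.swap_apply_left]
    · intro t ht
      have hne : ∀ p ∈ J, t ≠ p := fun p hp h => ht (h ▸ hp)
      rw [Equiv.Perm.mul_apply, Equiv.swap_apply_of_ne_of_ne (hne a ha) (hne i hi),
        Equiv.swap_apply_of_ne_of_ne (hne _ (hs a ha i hi b hb)) (hne j hj)]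
    · intro t ht
      exact hs _ (hs a ha i hi b hb) j hj _ (hs a ha i hi t ht)
  let B := basisOfLinearIndependentOfCardEqFinrank hcl hc
  let g : X ≃ₗ[F] X := B.equiv B π
  have hg : ∀ t, g (c t) = c (π t) := fun t => by
    have := B.equiv_apply t B π
    simpa [B] using this
  have hgx : g x = x := by
    rw [hx, map_sum]
    simp only [hg]
    refine Finset.sum_bij (fun t _ => π t) (fun t ht => hπJ t ht) (fun _ _ _ _ h => π.injective h)
      (fun t ht => ⟨π.symm t, ?_, by simp⟩) (fun _ _ => rfl)
    by_contra hcon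
    have := hπ _ hcon
    rw [Equiv.apply_symm_apply] at this
    exact hcon (this ▸ ht)
  have hgoff : ∀ y ∈ spanOn F c Jᶜ ⊔ Submodule.span F {x}, g y = y := by
    have hle : spanOn F c Jᶜ ⊔ Submodule.span F {x} ≤
        LinearMap.eqLocus (g : X →ₗ[F] X) LinearMap.id := by
      refine sup_le (spanOn_le fun t ht => ?_) ?_
      · change g (c t) = c t
        rw [hg, hπ t (by simpa using ht)]
      · rw [Submodule.span_singleton_le_iff_mem]
        exact hgx
    exact fun y hy => hle hy
  have hg' : ∀ t, g (c' t) = c' (π t) := fun t => by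
    by_cases ht : t ∈ J
    · rw [hcc t ht, hg, hcc _ (hπJ t ht)]
    · rw [hπ t ht, hgoff _ (hoff t ht)]
  have hupd : ∀ (v : ι → X) (p q : ι), (∀ t, g (v t) = v (π t)) → π p = q →
      g ∘ update v p x = update v q x ∘ π := by
    rintro v p _ hv rfl
    funext t
    by_cases ht : t = p
    · subst ht; simp [hgx]
    · simp [ht, hv]
  -- The sign of `π` enters once in each variable and so cancels.
  rw [← hΦ.inv g _ _ (hlic a ha) (hlic' b hb), hupd c a i hg hπa, hupd c' b j hg' hπb,
    (hΦ.left (update c' j x ∘ π) ((hlic' j hj).comp _ π.injective)).perm _ (hlic i hi) π,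
    (hΦ.right (update c i x) (hlic i hi)).perm _ (hlic' j hj) π, smul_smul,
    ← Units.val_mul, Int.units_mul_self, Units.val_one, one_smul]

/-- Up to signs and order, `d` and `d'` arise by putting `x` at two different places of bases `c`
and `c'` that share their members in `J`, with sum `x`. Expanding `Φ c c' = 0` along `x` in both
variables, the terms with equal places vanish by splitting, and all others equal `-Φ d d'`. Hence
`J.card * (J.card - 1)` kills `Φ d d'`. -/
theorem IsInvariantForm.eq_zero_of_update_sum [Module ℚ C] {Φ : (ι → X) → (ι → X) → C}
    (hΦ : IsInvariantForm F Φ) (hc : Fintype.card ι = Module.finrank F X)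
    (hvan : VanishesOnSplit F Φ)
    {J : Finset ι} {x : X} {d d' : ι → X} {i j : ι} (hi : i ∈ J) (hj : j ∈ J) (hij : i ≠ j)
    (hd : LinearIndependent F d) (hd' : LinearIndependent F d') (hdi : d i = x) (hdi' : d' i = x)
    (hdd : ∀ t ∈ J, t ≠ i → t ≠ j → d' t = d t) (hdj : d' j = x + ∑ t ∈ J.erase i, d t)
    (hoff : ∀ t ∉ J, d' t ∈ spanOn F d Jᶜ ⊔ Submodule.span F {x})
    (hzero : ∀ c c', LinearIndependent F c → LinearIndependent F c' → (∀ t ∉ J, c t = d t) →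
      (∀ t ∉ J, c' t = d' t) → (∀ t ∈ J, c t = c' t) → (∀ t ∈ J, c t ∈ spanOn F d J) →
      ∑ t ∈ J, c t = x → Φ c c' = 0) : Φ d d' = 0 := by
  have hjJ : j ∈ J.erase i := Finset.mem_erase.2 ⟨hij.symm, hj⟩
  set y : X := x + ∑ t ∈ J.erase i, d t with hy
  have hy' : y = x + (d j + ∑ t ∈ (J.erase i).erase j, d t) := by
    rw [hy, Finset.add_sum_erase _ _ hjJ]
  set a : ι → F := fun t => if t ∈ J.erase i then -1 else 1 with ha
  have ha0 : ∀ t, a t ≠ 0 := fun t => by simp only [ha]; split_ifs <;> simp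
  set da : ι → X := fun t => a t • d t with hda
  have hdal : LinearIndependent F da := linearIndependent_smul_of_ne_zero hc hd ha0
  have hdai : da i = x := by simp [hda, ha, hdi]
  have hdat : ∀ t ∈ J.erase i, da t = - d t := fun t ht => by simp only [hda, ha, if_pos ht]; simp
  have hdao : ∀ t ∉ J, da t = d t := fun t ht => by simp [hda, ha, ht]
  -- On `J` the members of `c` are `y` and the `-d t`, and `y` was chosen so that their sum is `x`.
  set c : ι → X := update da i y with hcdef
  have hcl : LinearIndependent F c := by
    refine linearIndependent_update hc hdal (J := J) (c := fun t => if t = i then 1 else -1)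
      ?_ hi (by simp)
    rw [← Finset.add_sum_erase _ _ hi, hy, if_pos rfl, one_smul, hdai]
    congr 1
    refine Finset.sum_congr rfl fun t ht => ?_
    rw [if_neg (Finset.ne_of_mem_erase ht), hdat t ht]; simp
  have hct : ∀ t ∈ J.erase i, c t = - d t := fun t ht => by
    rw [hcdef, update_of_ne (Finset.ne_of_mem_erase ht), hdat t ht]
  have hsum : ∑ t ∈ J, c t = x := by
    rw [← Finset.add_sum_erase _ _ hi, Finset.sum_congr rfl hct]
    simp [hcdef, hy]
  set a' : ι → F := fun t => if t ∈ (J.erase i).erase j then -1 else 1 with ha'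
  have ha0' : ∀ t, a' t ≠ 0 := fun t => by simp only [ha']; split_ifs <;> simp
  have hswl : LinearIndependent F (d' ∘ Equiv.swap i j) := hd'.comp _ (Equiv.injective _)
  set p : ι → X := fun t => a' t • (d' ∘ Equiv.swap i j) t with hp
  have hpl : LinearIndependent F p := linearIndependent_smul_of_ne_zero hc hswl ha0'
  have hpi : p i = y := by simp [hp, ha', hdj]
  have hpj : p j = x := by simp [hp, ha', hdi']
  have hpt : ∀ t ∈ (J.erase i).erase j, p t = - d t := fun t ht => by
    have h1 := Finset.mem_erase.1 ht
    have h2 := Finset.mem_erase.1 h1.2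
    simp only [hp, ha', if_pos ht, comp_apply, Equiv.swap_apply_of_ne_of_ne h2.1 h1.1,
      hdd t h2.2 h2.1 h1.1]
    simp
  have hpo : ∀ t ∉ J, p t = d' t := fun t ht => by
    have h1 : t ≠ i := by rintro rfl; exact ht hi
    have h2 : t ≠ j := by rintro rfl; exact ht hj
    simp [hp, ha', ht, Equiv.swap_apply_of_ne_of_ne h1 h2]
  -- Up to signs `p` is `d'` with the places `i` and `j` interchanged. Overwriting its entry `x` at
  -- `j` with `-d j` makes it agree with `c` on `J`.
  set c' : ι → X := update p j (-d j) with hcdef'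
  have hcl' : LinearIndependent F c' := by
    refine linearIndependent_update hc hpl (J := J) (c := fun t => if t = j then 1 else -1)
      ?_ hj (by simp)
    rw [← Finset.add_sum_erase _ _ hi, ← Finset.add_sum_erase _ _ hjJ, if_neg hij, if_pos rfl, hpi,
      hpj]
    have : ∀ t ∈ (J.erase i).erase j, (if t = j then (1 : F) else -1) • p t = d t := fun t ht => by
      rw [if_neg (Finset.ne_of_mem_erase ht), hpt t ht]; simp
    rw [Finset.sum_congr rfl this, hy']
    simp only [neg_smul, one_smul]
    abel
  have hcc : ∀ t ∈ J, c' t = c t := fun t ht => by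
    by_cases htj : t = j
    · subst htj; rw [hct t hjJ]; simp [hcdef']
    by_cases hti : t = i
    · subst hti; simp [hcdef', hcdef, hij, hpi]
    · have ht1 : t ∈ J.erase i := Finset.mem_erase.2 ⟨hti, ht⟩
      rw [hct t ht1, hcdef', update_of_ne htj, hpt t (Finset.mem_erase.2 ⟨htj, ht1⟩)]
  have hco : ∀ t ∉ J, c t = d t := fun t ht => by
    rw [hcdef, update_of_ne (by rintro rfl; exact ht hi), hdao t ht]
  have hco' : ∀ t ∉ J, c' t = d' t := fun t ht => by
    rw [hcdef', update_of_ne (by rintro rfl; exact ht hj), hpo t ht]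
  have hcJ : ∀ t ∈ J, c t ∈ spanOn F d J := fun t ht => by
    by_cases hti : t = i
    · subst hti
      rw [hcdef, update_self, hy, ← hdi]
      exact Submodule.add_mem _ (mem_spanOn d ht)
        (Submodule.sum_mem _ fun s hs => mem_spanOn d (Finset.mem_of_mem_erase hs))
    · rw [hct t (Finset.mem_erase.2 ⟨hti, ht⟩)]
      exact Submodule.neg_mem _ (mem_spanOn d ht)
  have h0 : Φ c c' = 0 := hzero c c' hcl hcl' hco hco' (fun t ht => (hcc t ht).symm) hcJ hsum
  have hoffc : ∀ t ∉ J, c' t ∈ spanOn F c Jᶜ ⊔ Submodule.span F {x} := fun t ht => by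
    rw [hco' t ht]
    have hle : spanOn F d Jᶜ ≤ spanOn F c Jᶜ := spanOn_le fun s hs => ?_
    · exact sup_le_sup_right hle _ (hoff t ht)
    rw [← hco s (by simpa using hs)]
    exact mem_spanOn c hs
  have hlic : ∀ t ∈ J, LinearIndependent F (update c t x) := fun t ht =>
    linearIndependent_update hc hcl (c := 1) (by simpa using hsum.symm) ht (by simp)
  have hsum' : ∑ t ∈ J, c' t = x := (Finset.sum_congr rfl hcc).trans hsum
  have hlic' : ∀ t ∈ J, LinearIndependent F (update c' t x) := fun t ht =>
    linearIndependent_update hc hcl' (c := 1) (by simpa using hsum'.symm) ht (by simp)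
  -- The minus sign is that of the transposition of `i` and `j`.
  have hτ : Φ (update c i x) (update c' j x) = - Φ d d' := by
    have h1 : update c i x = da := by rw [hcdef, update_idem, ← hdai, update_eq_self]
    have h2 : update c' j x = p := by rw [hcdef', update_idem, ← hpj, update_eq_self]
    rw [h1, h2, (hΦ.left p hpl).smul d hd a ha0, (hΦ.right d hd).smul _ hswl a' ha0',
      (hΦ.right d hd).perm d' hd', Equiv.Perm.sign_swap hij]
    simp
  have hdiag : ∀ s ∈ J, Φ (update c s x) (update c' s x) = 0 := fun s hs => by
    refine hvan.eq_zero_of_common (hlic s hs) (hlic' s hs) hs ?_ (by simp) (fun t ht => ?_)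
      (fun t ht => ?_)
    · by_cases hsi : s = i
      · exact ⟨j, by simp [hj, hsi, hij.symm]⟩
      · exact ⟨i, by simp [hi, Ne.symm hsi]⟩
    · have := mem_spanOn (F := F) (update c s x) ht
      rw [update_of_ne (Finset.ne_of_mem_erase ht)] at this ⊢
      rwa [hcc t (Finset.mem_of_mem_erase ht)]
    · have hts : t ≠ s := by rintro rfl; exact ht hs
      rw [update_of_ne hts, update_self]
      have hle : spanOn F c Jᶜ ≤ spanOn F (update c s x) Jᶜ := spanOn_le fun r hr => ?_
      · exact sup_le_sup_right hle _ (hoffc t ht)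
      have hrs : r ≠ s := by rintro rfl; simp [hs] at hr
      rw [← update_of_ne hrs x c]
      exact mem_spanOn _ hr
  have hexp : Φ c c' = ∑ s ∈ J, ∑ t ∈ J, Φ (update c s x) (update c' t x) := by
    rw [(hΦ.left c' hcl').rel c hcl J 1 x ⟨i, hi⟩ (by simp) (by simpa using hsum.symm)]
    exact Finset.sum_congr rfl fun s hs =>
      (hΦ.right _ (hlic s hs)).rel c' hcl' J 1 x ⟨i, hi⟩ (by simp) (by simpa using hsum'.symm)
  have hrow : ∀ s ∈ J, ∑ t ∈ J, Φ (update c s x) (update c' t x) = (J.card - 1) • -Φ d d' := by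
    intro s hs
    rw [← Finset.add_sum_erase _ _ hs, hdiag s hs, zero_add, ← Finset.card_erase_of_mem hs]
    refine Finset.sum_eq_card_nsmul fun t ht => ?_
    rw [hΦ.update_update_eq hc hcl hcl' hsum.symm hcc hoffc hi hj hs (Finset.mem_of_mem_erase ht)
      hij (Finset.ne_of_mem_erase ht).symm, hτ]
  rw [hexp, Finset.sum_congr rfl hrow, Finset.sum_const, smul_smul] at h0
  have hcard : 1 < J.card := Finset.one_lt_card.2 ⟨i, hi, j, hj, hij⟩
  have hn : ((J.card * (J.card - 1) : ℕ) : ℚ) ≠ 0 := by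
    have : J.card * (J.card - 1) ≠ 0 := by
      rw [mul_ne_zero_iff]; omega
    exact_mod_cast this
  rw [← Nat.cast_smul_eq_nsmul ℚ, smul_neg, neg_eq_zero, smul_eq_zero] at h0
  exact h0.resolve_left hn

end SplitPairs

/-! ### The descent on sum pairs -/

section Reduction

variable {F X C ι : Type*} [Field F] [AddCommGroup X] [Module F X] [AddCommGroup C]

theorem mem_spanOn_erase [DecidableEq ι] {e : ι → X} {J : Finset ι} {i : ι} (hi : i ∈ J) {y : X} :
    y ∈ spanOn F e J ↔ ∃ a : F, ∃ u ∈ spanOn F e (J.erase i), y = a • e i + u := by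
  rw [← Submodule.mem_span_insert, ← Set.image_insert_eq, ← Finset.coe_insert,
    Finset.insert_erase hi]

theorem notMem_spanOn_erase [DecidableEq ι] {e : ι → X} (he : LinearIndependent F e)
    (J : Finset ι) (i : ι) : e i ∉ spanOn F e (J.erase i) :=
  he.notMem_span_image (by simp)

theorem eq_zero_of_mem_spanOn {e : ι → X} {J : Finset ι} (f : X →ₗ[F] F)
    (hf : ∀ i ∈ J, f (e i) = 0) {y : X} (hy : y ∈ spanOn F e J) : f y = 0 :=
  (spanOn_le hf : spanOn F e J ≤ LinearMap.ker f) hy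

variable [Fintype ι] [DecidableEq ι]

/-- A pair of bases whose members indexed by `J` span the same subspace, which contains `x`, and
whose remaining members agree up to multiples of `x`, such that `Φ` vanishes if the
members indexed by `J` are replaced, in both bases, by the same vectors with sum `x`. -/
structure IsSumPair (F : Type*) {X C ι : Type*} [Field F] [AddCommGroup X] [Module F X]
    [AddCommGroup C] [Fintype ι] [DecidableEq ι] (Φ : (ι → X) → (ι → X) → C) (J : Finset ι) (x : X)
    (e e' : ι → X) : Prop where
  li : LinearIndependent F e
  li' : LinearIndependent F e'
  mem : ∀ t ∈ J, e' t ∈ spanOn F e J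
  x_mem : x ∈ spanOn F e J
  off : ∀ t ∉ J, e' t ∈ spanOn F e Jᶜ ⊔ Submodule.span F {x}
  zero : ∀ d d', LinearIndependent F d → LinearIndependent F d' → (∀ t ∉ J, d t = e t) →
    (∀ t ∉ J, d' t = e' t) → (∀ t ∈ J, d t = d' t) → (∀ t ∈ J, d t ∈ spanOn F e J) →
    ∑ t ∈ J, d t = x → Φ d d' = 0

variable [FiniteDimensional F X] {Φ : (ι → X) → (ι → X) → C} {J : Finset ι} {x : X} {e e' : ι → X}

/-- The conditions see the members in `J` only through their span, so these members may be moved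
within it. -/
theorem IsSumPair.congr (h : IsSumPair F Φ J x e e') {v v' : ι → X} (hv : LinearIndependent F v)
    (hv' : LinearIndependent F v') (hoff : ∀ t ∉ J, v t = e t) (hoff' : ∀ t ∉ J, v' t = e' t)
    (hJ : ∀ t ∈ J, v t ∈ spanOn F e J) (hJ' : ∀ t ∈ J, v' t ∈ spanOn F e J) :
    IsSumPair F Φ J x v v' := by
  have hs : spanOn F v J = spanOn F e J := spanOn_eq h.li hv hJ
  have ho : spanOn F e Jᶜ ≤ spanOn F v Jᶜ := spanOn_le fun t ht => by
    rw [← hoff t (by simpa using ht)]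
    exact mem_spanOn v ht
  refine ⟨hv, hv', fun t ht => hs ▸ hJ' t ht, hs ▸ h.x_mem, fun t ht => ?_, ?_⟩
  · rw [hoff' t ht]
    exact sup_le_sup_right ho _ (h.off t ht)
  · intro d d' hd hd' hdo hdo' hdd hdJ hx
    exact h.zero d d' hd hd' (fun t ht => (hdo t ht).trans (hoff t ht))
      (fun t ht => (hdo' t ht).trans (hoff' t ht)) hdd (hs ▸ hdJ) hx

variable [Module ℚ C]

/-- The pair is also a sum pair for `(J.erase i).erase j` and `u`. Its vanishing condition comes
from `IsInvariantForm.eq_zero_of_update_sum`: once the members there are replaced by vectors `d t`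
with sum `u`, the vector `e' j` is `x` plus the sum of the `d t` over `J.erase i`. -/
theorem IsSumPair.eq_zero_of_eq_add (hΦ : IsInvariantForm F Φ)
    (hc : Fintype.card ι = Module.finrank F X) (hvan : VanishesOnSplit F Φ)
    (ih : ∀ (I : Finset ι) (u : X) (v v' : ι → X), I.card < J.card → (u = 0 → I = ∅) →
      IsSumPair F Φ I u v v' → Φ v v' = 0)
    (h : IsSumPair F Φ J x e e') {i j : ι} (hi : i ∈ J) (hj : j ∈ J) (hij : i ≠ j)
    (hei : e i = x) (hei' : e' i = x)
    (hK : ∀ t ∈ (J.erase i).erase j, e' t ∈ spanOn F e ((J.erase i).erase j))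
    {u : X} (hu : u ∈ spanOn F e ((J.erase i).erase j)) (hej : e' j = x + e j + u) :
    Φ e e' = 0 := by
  have hjJ : j ∈ J.erase i := Finset.mem_erase.2 ⟨hij.symm, hj⟩
  set I : Finset ι := (J.erase i).erase j with hI
  have hIJ : I ⊆ J := (Finset.erase_subset _ _).trans (Finset.erase_subset _ _)
  have hiI : i ∉ I := by simp [hI]
  have hjI : j ∉ I := by simp [hI]
  have hmemI : ∀ t, t ∉ I → t ∉ J ∨ t = i ∨ t = j := fun t ht => by
    simp only [hI, Finset.mem_erase, not_and] at ht
    tauto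
  have hxI : x ∈ spanOn F e Iᶜ := hei ▸ mem_spanOn e (by simp [hiI])
  have hle : spanOn F e Jᶜ ⊔ Submodule.span F {x} ≤ spanOn F e Iᶜ := by
    refine sup_le (spanOn_mono e (Finset.compl_subset_compl.2 hIJ)) ?_
    rwa [Submodule.span_singleton_le_iff_mem]
  have hoffI : ∀ t ∉ I, e' t ∈ spanOn F e Iᶜ ⊔ Submodule.span F {u} := fun t ht => by
    rcases hmemI t ht with htJ | rfl | rfl
    · exact Submodule.mem_sup_left (hle (h.off t htJ))
    · rw [hei']
      exact Submodule.mem_sup_left hxI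
    · rw [hej]
      exact Submodule.add_mem_sup (Submodule.add_mem _ hxI (mem_spanOn e (by simpa using ht)))
        (Submodule.mem_span_singleton_self u)
  -- For `u = 0` there is nothing to expand along, but then the pair splits along `I` and its
  -- complement.
  by_cases hcase : u = 0 → I = ∅
  swap
  · push Not at hcase
    obtain ⟨rfl, hne⟩ := hcase
    refine hvan e e' h.li h.li' I hne ⟨i, by simpa using hiI⟩ hK fun t ht => ?_
    simpa using hoffI t ht
  refine ih I u e e' ?_ hcase ⟨h.li, h.li', hK, hu, hoffI, ?_⟩
  · exact Finset.card_lt_card (Finset.ssubset_iff_of_subset hIJ |>.2 ⟨i, hi, hiI⟩)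
  intro d d' hd hd' hdo hdo' hdd hdI hdu
  have hdJ : ∀ t ∈ J, d t ∈ spanOn F e J := fun t ht => by
    by_cases htI : t ∈ I
    · exact spanOn_mono e hIJ (hdI t htI)
    · rw [hdo t htI]; exact mem_spanOn e ht
  have hdoJ : ∀ t ∉ J, d t = e t := fun t ht => hdo t fun h => ht (hIJ h)
  have hdoJ' : ∀ t ∉ J, d' t = e' t := fun t ht => hdo' t fun h => ht (hIJ h)
  have hdJ' : ∀ t ∈ J, d' t ∈ spanOn F e J := fun t ht => by
    by_cases htI : t ∈ I
    · rw [← hdd t htI]; exact hdJ t ht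
    · rw [hdo' t htI]; exact h.mem t ht
  have hsp := h.congr hd hd' hdoJ hdoJ' hdJ hdJ'
  refine hΦ.eq_zero_of_update_sum hc hvan hi hj hij hd hd' ((hdo i hiI).trans hei)
    ((hdo' i hiI).trans hei') (fun t ht hti htj => (hdd t ?_).symm) ?_ hsp.off ?_
  · exact Finset.mem_erase.2 ⟨htj, Finset.mem_erase.2 ⟨hti, ht⟩⟩
  · rw [hdo' j hjI, hej, ← Finset.add_sum_erase _ _ hjJ, hdu, hdo j hjI, add_assoc]
  · exact hsp.zero

/-- Inside the span of `J`, each functional cuts out the hyperplane spanned by the `J.erase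
i`-members of the opposite basis. If the hyperplanes coincide, the pair splits. Otherwise the
members other than `i` and `j` lie in their intersection, and rescaling the `j`-th vectors yields
the form `e' j = x + e j + u`. -/
theorem IsSumPair.eq_zero_of_functionals (hΦ : IsInvariantForm F Φ)
    (hc : Fintype.card ι = Module.finrank F X) (hvan : VanishesOnSplit F Φ)
    (ih : ∀ (I : Finset ι) (u : X) (v v' : ι → X), I.card < J.card → (u = 0 → I = ∅) →
      IsSumPair F Φ I u v v' → Φ v v' = 0)
    (h : IsSumPair F Φ J x e e') {i j : ι} (hi : i ∈ J) (hj : j ∈ J.erase i)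
    (hei : e i = x) (hei' : e' i = x) (f f' : X →ₗ[F] F)
    (hf : ∀ y ∈ spanOn F e J, f y = 0 ↔ y ∈ spanOn F e' (J.erase i))
    (hf' : ∀ y ∈ spanOn F e J, f' y = 0 ↔ y ∈ spanOn F e (J.erase i))
    (hfj : ∀ t ∈ J.erase i, t ≠ j → f (e t) = 0)
    (hfj' : ∀ t ∈ J.erase i, t ≠ j → f' (e' t) = 0) : Φ e e' = 0 := by
  by_cases hY : ∀ t ∈ J.erase i, e' t ∈ spanOn F e (J.erase i)
  · exact hvan.eq_zero_of_common h.li h.li' hi ⟨j, hj⟩ (hei'.trans hei.symm) hY (by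
      rw [hei]; exact h.off)
  have hjJ := Finset.mem_of_mem_erase hj
  have hsub : ∀ t ∈ J.erase i, e t ∈ spanOn F e J := fun t ht =>
    mem_spanOn e (Finset.mem_of_mem_erase ht)
  have hIe : spanOn F e ((J.erase i).erase j) ≤ spanOn F e (J.erase i) :=
    spanOn_mono e (Finset.erase_subset _ _)
  have hfI : ∀ y ∈ spanOn F e ((J.erase i).erase j), f y = 0 := fun y hy =>
    eq_zero_of_mem_spanOn f (fun t ht =>
      hfj t (Finset.mem_of_mem_erase ht) (Finset.ne_of_mem_erase ht)) hy
  -- Otherwise all of `e` on `J.erase i` would lie in the hyperplane of `e'`, and the two would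
  -- coincide.
  have hfe : f (e j) ≠ 0 := fun h0 => by
    refine hY fun t ht => ?_
    rw [spanOn_eq h.li' h.li fun s hs => (hf _ (hsub s hs)).1 (by
      by_cases hsj : s = j
      · rw [hsj, h0]
      · exact hfj s hs hsj)]
    exact mem_spanOn e' ht
  have hK : ∀ y ∈ spanOn F e (J.erase i), f y = 0 → y ∈ spanOn F e ((J.erase i).erase j) := by
    intro y hy hfy
    obtain ⟨a, u, hu, rfl⟩ := (mem_spanOn_erase hj).1 hy
    rw [map_add, map_smul, hfI u hu, add_zero, smul_eq_mul, mul_eq_zero, or_iff_left hfe] at hfy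
    simpa [hfy] using hu
  have hKe : ∀ t ∈ (J.erase i).erase j, e' t ∈ spanOn F e ((J.erase i).erase j) := fun t ht => by
    have htJ := Finset.mem_of_mem_erase ht
    have hm := h.mem t (Finset.mem_of_mem_erase htJ)
    exact hK _ ((hf' _ hm).1 (hfj' t htJ (Finset.ne_of_mem_erase ht)))
      ((hf _ hm).2 (mem_spanOn e' htJ))
  -- Write `e' j = a • x + b • e j + u`. If `a = 0`, the hyperplanes coincide; if `b = 0`, applying
  -- `f` gives `f x = 0`, although `x` is transverse to the hyperplane of `e'`.
  obtain ⟨a, w, hw, hae⟩ := (mem_spanOn_erase hi).1 (h.mem j hjJ)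
  have ha : a ≠ 0 := by
    rintro rfl
    refine hY fun t ht => ?_
    by_cases htj : t = j
    · rw [htj, hae]; simpa using hw
    · exact hIe (hKe t (Finset.mem_erase.2 ⟨htj, ht⟩))
  obtain ⟨b, u, hu, rfl⟩ := (mem_spanOn_erase hj).1 hw
  have hfx : f x ≠ 0 := fun h0 =>
    notMem_spanOn_erase h.li' J i (by rw [hei']; exact (hf x h.x_mem).1 h0)
  have hb : b ≠ 0 := by
    rintro rfl
    have h1 : f (e' j) = 0 := (hf _ (h.mem j hjJ)).2 (mem_spanOn e' hj)
    rw [hae, hei, zero_smul, zero_add, map_add, map_smul, hfI u hu, add_zero, smul_eq_mul,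
      mul_eq_zero] at h1
    tauto
  -- Scaling `e' j` by `a⁻¹` and `e j` by `a⁻¹ * b` turns both coefficients into `1`.
  set s : ι → F := fun t => if t = j then a⁻¹ * b else 1 with hs
  set s' : ι → F := fun t => if t = j then a⁻¹ else 1 with hs'
  have hs0 : ∀ t, s t ≠ 0 := fun t => by simp only [hs]; split_ifs <;> simp [ha, hb]
  have hs0' : ∀ t, s' t ≠ 0 := fun t => by simp only [hs']; split_ifs <;> simp [ha]
  have hv := linearIndependent_smul_of_ne_zero hc h.li hs0
  have hv' := linearIndependent_smul_of_ne_zero hc h.li' hs0'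
  rw [← (hΦ.left e' h.li').smul e h.li s hs0, ← (hΦ.right _ hv).smul e' h.li' s' hs0']
  have hij : i ≠ j := (Finset.ne_of_mem_erase hj).symm
  have hne : ∀ t ∉ J, t ≠ j := by rintro t ht rfl; exact ht hjJ
  have hsp := h.congr hv hv' (fun t ht => by simp [hs, hne t ht])
    (fun t ht => by simp [hs', hne t ht])
    (fun t ht => Submodule.smul_mem _ _ (mem_spanOn e ht))
    (fun t ht => Submodule.smul_mem _ _ (h.mem t ht))
  have hspan : spanOn F e ((J.erase i).erase j) =
      spanOn F (fun t => s t • e t) ((J.erase i).erase j) :=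
    (spanOn_eq h.li hv fun t ht => Submodule.smul_mem _ _ (mem_spanOn e ht)).symm
  refine hsp.eq_zero_of_eq_add hΦ hc hvan ih hi hjJ hij (by simp [hs, hij, hei])
    (by simp [hs', hij, hei']) (fun t ht => ?_) (u := a⁻¹ • u) ?_ ?_
  · exact hspan ▸ Submodule.smul_mem _ _ (hKe t ht)
  · exact hspan ▸ Submodule.smul_mem _ _ hu
  · simp only [hs, hs', if_pos, hae, smul_add, smul_smul, inv_mul_cancel₀ ha, one_smul, hei,
      add_assoc]

omit [FiniteDimensional F X] in
theorem exists_functional_spanOn_erase (hc : Fintype.card ι = Module.finrank F X)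
    (he : LinearIndependent F e) {i : ι} (hi : i ∈ J) :
    ∃ f : X →ₗ[F] F, ∀ y ∈ spanOn F e J, f y = 0 ↔ y ∈ spanOn F e (J.erase i) := by
  have : Nonempty ι := ⟨i⟩
  let B := basisOfLinearIndependentOfCardEqFinrank he hc
  have hB : ∀ t, B t = e t := fun t => by simp [B]
  have h0 : ∀ y ∈ spanOn F e (J.erase i), B.coord i y = 0 := fun y hy =>
    eq_zero_of_mem_spanOn _ (fun t ht => by
      rw [← hB t, Module.Basis.coord_apply, Module.Basis.repr_self]
      exact Finsupp.single_eq_of_ne (Finset.ne_of_mem_erase ht).symm) hy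
  refine ⟨B.coord i, fun y hy => ⟨fun hy0 => ?_, h0 y⟩⟩
  obtain ⟨a, u, hu, rfl⟩ := (mem_spanOn_erase hi).1 hy
  have ha : a = 0 := by
    rw [map_add, h0 u hu, map_smul, ← hB i, Module.Basis.coord_apply, Module.Basis.repr_self] at hy0
    simpa using hy0
  simpa [ha] using hu

/-- Each basis is moved into position relative to the hyperplane of the other by
`IsModularSymbol.eq_zero_of_hyperplane`. This changes the members in `J.erase i` only within their
span, so the functionals `f` and `f'`, chosen beforehand, keep their meaning. A transposition aligns
the two exceptional places. -/
theorem IsSumPair.eq_zero_of_common (hΦ : IsInvariantForm F Φ)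
    (hc : Fintype.card ι = Module.finrank F X) (hvan : VanishesOnSplit F Φ)
    (ih : ∀ (I : Finset ι) (u : X) (v v' : ι → X), I.card < J.card → (u = 0 → I = ∅) →
      IsSumPair F Φ I u v v' → Φ v v' = 0)
    (h : IsSumPair F Φ J x e e') {i : ι} (hi : i ∈ J)
    (hei : e i = x) (hei' : e' i = x) : Φ e e' = 0 := by
  -- If `J = {i}`, the common member `x` is itself the sum over `J`, and the vanishing condition
  -- applies directly.
  rcases (J.erase i).eq_empty_or_nonempty with hJ | hJ
  · refine h.zero e e' h.li h.li' (fun _ _ => rfl) (fun _ _ => rfl) (fun t ht => ?_)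
      (fun t ht => mem_spanOn e ht) ?_
    · have : t = i := by
        by_contra hti
        exact Finset.notMem_empty t (hJ ▸ Finset.mem_erase.2 ⟨hti, ht⟩)
      rw [this, hei, hei']
    · rw [← Finset.add_sum_erase _ _ hi, hJ, hei]; simp
  have hss : spanOn F e' J = spanOn F e J := spanOn_eq h.li h.li' h.mem
  obtain ⟨f, hf⟩ := exists_functional_spanOn_erase hc h.li' hi
  obtain ⟨f', hf'⟩ := exists_functional_spanOn_erase hc h.li hi
  rw [hss] at hf
  have hiJ : i ∉ J.erase i := by simp
  have hJJ : ∀ t ∉ J, t ∉ J.erase i := fun t ht h => ht (Finset.mem_of_mem_erase h)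
  have hin : ∀ (w : ι → X), w i = x → (∀ t ∈ J.erase i, w t ∈ spanOn F e J) →
      ∀ t ∈ J, w t ∈ spanOn F e J := fun w hw hwt t ht => by
    by_cases hti : t = i
    · rw [hti, hw]; exact h.x_mem
    · exact hwt t (Finset.mem_erase.2 ⟨hti, ht⟩)
  refine (hΦ.left e' h.li').eq_zero_of_hyperplane hc hJ f h.li fun v hv hvo hvJ hvf => ?_
  refine (hΦ.right v hv).eq_zero_of_hyperplane hc hJ f' h.li' fun v' hv' hvo' hvJ' hvf' => ?_
  obtain ⟨j, hj, hvj⟩ := hvf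
  obtain ⟨j', hj', hvj'⟩ := hvf'
  have hvi : v i = x := (hvo i hiJ).trans hei
  have hswl : LinearIndependent F (v' ∘ Equiv.swap j j') := hv'.comp _ (Equiv.injective _)
  have hswJ : ∀ t ∈ J.erase i, Equiv.swap j j' t ∈ J.erase i := fun t ht => by
    rw [Equiv.swap_apply_def]; split_ifs <;> assumption
  have hswo : ∀ t ∉ J.erase i, Equiv.swap j j' t = t := fun t ht =>
    Equiv.swap_apply_of_ne_of_ne (by rintro rfl; exact ht hj) (by rintro rfl; exact ht hj')
  have hswo' : ∀ t ∉ J.erase i, (v' ∘ Equiv.swap j j') t = e' t := fun t ht => by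
    rw [comp_apply, hswo t ht, hvo' t ht]
  have hmono := spanOn_mono (F := F) e (Finset.erase_subset i J)
  have hmono' : spanOn F e' (J.erase i) ≤ spanOn F e J :=
    hss ▸ spanOn_mono (F := F) e' (Finset.erase_subset i J)
  have hsp : IsSumPair F Φ J x v (v' ∘ Equiv.swap j j') :=
    h.congr hv hswl (fun t ht => hvo t (hJJ t ht)) (fun t ht => hswo' t (hJJ t ht))
      (hin v hvi fun t ht => hmono (hvJ t ht))
      (hin _ ((hswo' i hiJ).trans hei') fun t ht => hmono' (hvJ' _ (hswJ t ht)))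
  have hsv : spanOn F v J = spanOn F e J :=
    spanOn_eq h.li hv (hin v hvi fun t ht => hmono (hvJ t ht))
  have hzero : Φ v (v' ∘ Equiv.swap j j') = 0 := by
    refine hsp.eq_zero_of_functionals hΦ hc hvan ih hi hj hvi ((hswo' i hiJ).trans hei') f f'
      ?_ ?_ hvj fun t ht htj => hvj' _ (hswJ t ht) fun h => htj ?_
    · rw [hsv, spanOn_eq h.li' hswl fun t ht => hvJ' _ (hswJ t ht)]
      exact hf
    · rw [hsv, spanOn_eq h.li hv hvJ]
      exact hf'
    · rw [Equiv.swap_apply_eq_iff, Equiv.swap_apply_right] at h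
      exact h
  rw [(hΦ.right v hv).perm v' hv'] at hzero
  rcases Int.units_eq_one_or (Equiv.Perm.sign (Equiv.swap j j')) with hs | hs <;>
    simpa [hs] using hzero

/-- Expansion in both variables puts `x` into both bases, and a transposition moves it to the same
index. The hypothesis on `x` guarantees a nonzero vector to expand along unless `J` is empty, and
then the vanishing condition is the claim itself. -/
theorem IsSumPair.eq_zero (hΦ : IsInvariantForm F Φ) (hc : Fintype.card ι = Module.finrank F X)
    (hvan : VanishesOnSplit F Φ) (hx : x = 0 → J = ∅) (h : IsSumPair F Φ J x e e') :
    Φ e e' = 0 := by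
  induction hn : J.card using Nat.strong_induction_on generalizing J x e e' with
  | _ n ih =>
  subst hn
  rcases J.eq_empty_or_nonempty with rfl | hJ
  · exact h.zero e e' h.li h.li' (fun _ _ => rfl) (fun _ _ => rfl) (by simp) (by simp) (by
      have hx0 := h.x_mem
      rw [spanOn, Finset.coe_empty, Set.image_empty, Submodule.span_empty] at hx0
      rw [Finset.sum_empty, (Submodule.mem_bot F).1 hx0])
  have hx0 : x ≠ 0 := fun h0 => hJ.ne_empty (hx h0)
  have hss : spanOn F e' J = spanOn F e J := spanOn_eq h.li h.li' h.mem
  refine (hΦ.left e' h.li').eq_zero_of_update hc h.li h.x_mem hx0 fun i hi hv => ?_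
  refine (hΦ.right _ hv).eq_zero_of_update hc h.li' (hss ▸ h.x_mem) hx0 fun j hj hv' => ?_
  have hmemu : ∀ (w : ι → X) (k : ι), (∀ t ∈ J, w t ∈ spanOn F e J) →
      ∀ t ∈ J, update w k x t ∈ spanOn F e J := fun w k hw t ht => by
    by_cases htk : t = k
    · rw [htk, update_self]; exact h.x_mem
    · rw [update_of_ne htk]; exact hw t ht
  have hoff : ∀ (w : ι → X) (k : ι), k ∈ J → ∀ t ∉ J, update w k x t = w t := fun w k hk t ht =>
    update_of_ne (by rintro rfl; exact ht hk) _ _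
  have hswJ : ∀ t ∈ J, Equiv.swap i j t ∈ J := fun t ht => by
    rw [Equiv.swap_apply_def]; split_ifs <;> assumption
  have hswo : ∀ t ∉ J, Equiv.swap i j t = t := fun t ht =>
    Equiv.swap_apply_of_ne_of_ne (by rintro rfl; exact ht hi) (by rintro rfl; exact ht hj)
  have hswl : LinearIndependent F (update e' j x ∘ Equiv.swap i j) :=
    hv'.comp _ (Equiv.injective _)
  have hsp : IsSumPair F Φ J x (update e i x) (update e' j x ∘ Equiv.swap i j) :=
    h.congr hv hswl (hoff e i hi)
      (fun t ht => by rw [comp_apply, hswo t ht]; exact hoff e' j hj t ht)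
      (hmemu e i fun t ht => mem_spanOn e ht)
      (fun t ht => hmemu e' j h.mem _ (hswJ t ht))
  have hzero := hsp.eq_zero_of_common hΦ hc hvan
    (fun I u v v' hI hu hp => ih I.card hI hu hp rfl) hi (by simp) (by simp)
  rw [(hΦ.right _ hv).perm _ hv'] at hzero
  rcases Int.units_eq_one_or (Equiv.Perm.sign (Equiv.swap i j)) with hs | hs <;>
    simpa [hs] using hzero

end Reduction

/-! ### Restricting a form to part of the basis -/

section Gluing

variable {F X C ι : Type*} [Field F] [AddCommGroup X] [Module F X] [AddCommGroup C]
variable [DecidableEq ι]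

/-- The family that is given by `a` on `J` and by `o` outside of `J`. -/
def glue {ι X : Type*} [DecidableEq ι] (J : Finset ι) (a : J → X) (o : ι → X) (t : ι) : X :=
  if h : t ∈ J then a ⟨t, h⟩ else o t

omit [AddCommGroup X] in
theorem glue_mem {J : Finset ι} {a : J → X} {o : ι → X} (t : J) : glue J a o t = a t := by
  simp [glue]

omit [AddCommGroup X] in
theorem glue_notMem {J : Finset ι} {a : J → X} {o : ι → X} {t : ι} (ht : t ∉ J) :
    glue J a o t = o t := by
  simp [glue, ht]

omit [AddCommGroup X] in
theorem eq_glue {J : Finset ι} {a : J → X} {o v : ι → X} (hJ : ∀ t : J, v t = a t)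
    (ho : ∀ t ∉ J, v t = o t) : v = glue J a o := by
  funext t
  by_cases ht : t ∈ J
  · rw [hJ ⟨t, ht⟩]; exact (glue_mem (o := o) ⟨t, ht⟩).symm
  · rw [ho t ht, glue_notMem ht]

variable [Fintype ι]

/-- The relations survive freezing the members outside `J`: scalars are extended by `1`,
permutations by the identity, coefficients by `0`. -/
theorem IsModularSymbol.comp_glue {φ : (ι → X) → C} (hφ : IsModularSymbol F φ) (J : Finset ι)
    (o : ι → X) {A : Submodule F X}
    (hli : ∀ a : J → A, LinearIndependent F a →
      LinearIndependent F (glue J (fun t => (a t : X)) o)) :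
    IsModularSymbol F (fun a : J → A => φ (glue J (fun t => (a t : X)) o)) where
  smul a ha b hb := by
    rw [← hφ.smul _ (hli a ha) (glue J b 1) fun t => ?_]
    · congr 1
      symm
      exact eq_glue (fun t => by simp [glue_mem]) (fun t ht => by simp [glue_notMem ht])
    · by_cases ht : t ∈ J
      · exact (glue_mem (a := b) (o := 1) ⟨t, ht⟩).symm ▸ hb _
      · simp [glue_notMem ht]
  perm a ha σ := by
    rw [← Equiv.Perm.sign_ofSubtype, ← hφ.perm _ (hli a ha)]
    congr 1
    symm
    refine eq_glue (fun t => ?_) (fun t ht => ?_)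
    · rw [comp_apply, Equiv.Perm.ofSubtype_apply_coe, glue_mem, comp_apply]
    · rw [comp_apply, Equiv.Perm.ofSubtype_apply_of_not_mem _ ht, glue_notMem ht]
  rel a ha I c x hI hc hx := by
    rw [hφ.rel _ (hli a ha) (I.map (Embedding.subtype _)) (glue J c 0) x
      (by simpa using hI) ?_ ?_, Finset.sum_map]
    · refine Finset.sum_congr rfl fun i _ => ?_
      congr 1
      refine eq_glue (fun t => ?_) (fun t ht => ?_)
      · by_cases hti : t = i
        · subst hti; simp
        · have hti' : (t : ι) ≠ Embedding.subtype (· ∈ J) i := fun h => hti (Subtype.ext h)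
          rw [update_of_ne hti, update_of_ne hti', glue_mem]
      · rw [update_of_ne (by rintro rfl; exact ht i.2), glue_notMem ht]
    · intro i hi
      obtain ⟨i, hi', rfl⟩ := Finset.mem_map.1 hi
      rw [Embedding.subtype_apply, glue_mem]
      exact hc i hi'
    · rw [Finset.sum_map, hx]
      simp [glue_mem]

variable [FiniteDimensional F X]

theorem linearIndependent_glue (hc : Fintype.card ι = Module.finrank F X) {e o : ι → X}
    (he : LinearIndependent F e) (ho : LinearIndependent F o) {J : Finset ι}
    (hoJ : ∀ t ∉ J, o t ∈ spanOn F e Jᶜ) {a : J → spanOn F e J} (ha : LinearIndependent F a) :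
    LinearIndependent F (glue J (fun t => (a t : X)) o) := by
  refine linearIndependent_of_mem_span hc he fun t => ?_
  by_cases ht : t ∈ J
  · have htop := ha.span_eq_top_of_card_eq_finrank' (by rw [finrank_spanOn he, Fintype.card_coe])
    have h1 : (⟨e t, mem_spanOn e ht⟩ : spanOn F e J) ∈ Submodule.span F (Set.range a) := by
      rw [htop]; trivial
    have h2 := Submodule.mem_map_of_mem (f := (spanOn F e J).subtype) h1
    rw [Submodule.map_span] at h2
    refine Submodule.span_mono ?_ h2
    rintro _ ⟨_, ⟨s, rfl⟩, rfl⟩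
    exact ⟨s, glue_mem s⟩
  · have h1 := mem_spanOn (F := F) e (Finset.mem_compl.2 ht)
    rw [← spanOn_eq he ho fun s hs => hoJ s (Finset.mem_compl.1 hs)] at h1
    refine (spanOn_le fun s hs => ?_ : spanOn F o Jᶜ ≤ _) h1
    exact Submodule.subset_span ⟨s, glue_notMem (Finset.mem_compl.1 hs)⟩

omit [FiniteDimensional F X] in
theorem exists_linearEquiv_extend {A B : Submodule F X} (h : IsCompl A B) (g : A ≃ₗ[F] A) :
    ∃ g' : X ≃ₗ[F] X, (∀ a : A, g' a = g a) ∧ ∀ b ∈ B, g' b = b := by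
  let E := Submodule.prodEquivOfIsCompl A B h
  refine ⟨E.symm.trans ((g.prodCongr (LinearEquiv.refl F B)).trans E), fun a => ?_, fun b hb => ?_⟩
  · simp [E]
  · have := Submodule.prodEquivOfIsCompl_symm_apply_right A B h ⟨b, hb⟩
    simp only [LinearEquiv.trans_apply, E]
    rw [this]
    simp

/-- An automorphism of the span of `J` extends by the identity on the complementary span, which
contains all frozen members. -/
theorem IsInvariantForm.comp_glue {Φ : (ι → X) → (ι → X) → C} (hΦ : IsInvariantForm F Φ)
    (hc : Fintype.card ι = Module.finrank F X) {e e' : ι → X} (he : LinearIndependent F e)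
    (he' : LinearIndependent F e') {J : Finset ι} (ho : ∀ t ∉ J, e' t ∈ spanOn F e Jᶜ) :
    IsInvariantForm F (fun a b : J → spanOn F e J =>
      Φ (glue J (fun t => (a t : X)) e) (glue J (fun t => (b t : X)) e')) where
  left b hb := (hΦ.left _ (linearIndependent_glue hc he he' ho hb)).comp_glue J e fun _ ha =>
    linearIndependent_glue hc he he (fun _ ht => mem_spanOn e (Finset.mem_compl.2 ht)) ha
  right a ha := (hΦ.right _ (linearIndependent_glue hc he he
    (fun _ ht => mem_spanOn e (Finset.mem_compl.2 ht)) ha)).comp_glue J e' fun _ hb =>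
      linearIndependent_glue hc he he' ho hb
  inv g a b ha hb := by
    have hcompl : IsCompl (spanOn F e J) (spanOn F e Jᶜ) :=
      he.isCompl_span_image (he.span_eq_top_of_card_eq_finrank' hc) (by
        rw [Finset.coe_compl]; exact isCompl_compl)
    obtain ⟨g', hgA, hgB⟩ := exists_linearEquiv_extend hcompl g
    have hglue : ∀ (a : J → spanOn F e J) (o : ι → X), (∀ t ∉ J, o t ∈ spanOn F e Jᶜ) →
        g' ∘ glue J (fun t => (a t : X)) o =
          glue J (fun t => ((g ∘ a) t : X)) o := fun a o ho =>
      eq_glue (fun t => by rw [comp_apply, glue_mem, hgA, comp_apply])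
        (fun t ht => by rw [comp_apply, glue_notMem ht, hgB _ (ho t ht)])
    have heo : ∀ t ∉ J, e t ∈ spanOn F e Jᶜ := fun _ ht => mem_spanOn e (Finset.mem_compl.2 ht)
    rw [← hglue a e heo, ← hglue b e' ho]
    exact hΦ.inv g' _ _ (linearIndependent_glue hc he he heo ha)
      (linearIndependent_glue hc he he' ho hb)

end Gluing

/-! ### Invariant forms are determined by the diagonal -/

section Uniqueness

universe u v w

variable {F : Type*} [Field F] {C : Type w} [AddCommGroup C] [Module ℚ C]

omit [Module ℚ C] in
theorem IsInvariantForm.eq_zero_of_glue {n : ℕ}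
    (ih : ∀ m < n, ∀ {ι : Type u} {X : Type v} [Fintype ι] [DecidableEq ι] [AddCommGroup X]
      [Module F X] [FiniteDimensional F X] {Φ : (ι → X) → (ι → X) → C}, IsInvariantForm F Φ →
      Fintype.card ι = m → Module.finrank F X = m →
      (∀ b, LinearIndependent F b → Φ b b = 0) →
      ∀ e e', LinearIndependent F e → LinearIndependent F e' → Φ e e' = 0)
    {ι : Type u} {X : Type v} [Fintype ι] [DecidableEq ι] [AddCommGroup X]
    [Module F X] [FiniteDimensional F X] {Φ : (ι → X) → (ι → X) → C} (hΦ : IsInvariantForm F Φ)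
    (hι : Fintype.card ι = n) (hX : Module.finrank F X = n) {J : Finset ι} (hJ : Jᶜ.Nonempty)
    {e e' : ι → X} (he : LinearIndependent F e)
    (he' : LinearIndependent F e') (hm : ∀ t ∈ J, e' t ∈ spanOn F e J)
    (ho : ∀ t ∉ J, e' t ∈ spanOn F e Jᶜ)
    (h0 : ∀ b : J → spanOn F e J, LinearIndependent F b →
      Φ (glue J (fun t => (b t : X)) e) (glue J (fun t => (b t : X)) e') = 0) : Φ e e' = 0 := by
  have hc := hι.trans hX.symm
  have hlt : J.card < n := by
    have h1 := J.card_add_card_compl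
    have h2 := hJ.card_pos
    omega
  have hres : ∀ w : ι → X, LinearIndependent F w → ∀ hw : ∀ t ∈ J, w t ∈ spanOn F e J,
      LinearIndependent F (fun t : J => (⟨w t, hw t t.2⟩ : spanOn F e J)) := fun w hwl hw => by
    refine LinearIndependent.of_comp (spanOn F e J).subtype ?_
    exact hwl.comp ((↑) : J → ι) Subtype.val_injective
  have h := ih J.card hlt (hΦ.comp_glue hc he he' ho) (Fintype.card_coe J) (finrank_spanOn he J) h0
    _ _ (hres e he fun t ht => mem_spanOn e ht) (hres e' he' hm)
  convert h using 1
  congr 1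
  · exact eq_glue (fun _ => rfl) (fun _ _ => rfl)
  · exact eq_glue (fun _ => rfl) (fun _ _ => rfl)

/-- An invariant form that vanishes on the diagonal is zero. -/
theorem IsInvariantForm.eq_zero (n : ℕ) : ∀ {ι : Type u} {X : Type v} [Fintype ι] [DecidableEq ι]
    [AddCommGroup X] [Module F X] [FiniteDimensional F X] {Φ : (ι → X) → (ι → X) → C},
    IsInvariantForm F Φ → Fintype.card ι = n → Module.finrank F X = n →
    (∀ b, LinearIndependent F b → Φ b b = 0) →
    ∀ e e', LinearIndependent F e → LinearIndependent F e' → Φ e e' = 0 := by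
  induction n using Nat.strong_induction_on with
  | _ n ih =>
  intro ι X _ _ _ _ _ Φ hΦ hι hX hdiag e e' he he'
  have hc := hι.trans hX.symm
  -- One use of the induction hypothesis makes the members in `J` equal, a second one those in `Jᶜ`;
  -- what is left is a diagonal pair.
  have hvan : VanishesOnSplit F Φ := by
    intro e e' he he' J hJ hJc hm ho
    refine hΦ.eq_zero_of_glue ih hι hX hJc he he' hm ho fun b hb => ?_
    have heo : ∀ t ∉ J, e t ∈ spanOn F e Jᶜ := fun _ ht => mem_spanOn e (Finset.mem_compl.2 ht)
    have hl := linearIndependent_glue hc he he heo hb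
    have hl' := linearIndependent_glue hc he he' ho hb
    have hsp : spanOn F e Jᶜ ≤ spanOn F (glue J (fun t => (b t : X)) e) Jᶜ :=
      spanOn_le fun t ht => by
        rw [← glue_notMem (a := fun t => (b t : X)) (o := e) (Finset.mem_compl.1 ht)]
        exact mem_spanOn _ ht
    refine hΦ.eq_zero_of_glue ih hι hX (J := Jᶜ) (by rwa [compl_compl]) hl hl' (fun t ht => ?_)
      (fun t ht => ?_) fun c hcl => ?_
    · rw [glue_notMem (Finset.mem_compl.1 ht)]
      exact hsp (ho t (Finset.mem_compl.1 ht))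
    · have htJ : t ∈ J := by simpa using ht
      have h1 : t ∈ Jᶜᶜ := by simpa using htJ
      have h2 := mem_spanOn (F := F) (glue J (fun t => (b t : X)) e) h1
      rw [glue_mem ⟨t, htJ⟩] at h2 ⊢
      exact h2
    · have : glue Jᶜ (fun t => (c t : X)) (glue J (fun t => (b t : X)) e') =
          glue Jᶜ (fun t => (c t : X)) (glue J (fun t => (b t : X)) e) :=
        eq_glue (fun t => glue_mem t) fun t ht => by
          have htJ : t ∈ J := by simpa using ht
          rw [glue_notMem ht, glue_mem ⟨t, htJ⟩, glue_mem ⟨t, htJ⟩]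
      rw [this]
      exact hdiag _ (linearIndependent_glue hc hl hl
        (fun _ ht => mem_spanOn _ (Finset.mem_compl.2 ht)) hcl)
  have htop : ∀ y : X, y ∈ spanOn F e Finset.univ := fun y => by
    rw [spanOn, Finset.coe_univ, Set.image_univ, he.span_eq_top_of_card_eq_finrank' hc]
    trivial
  -- When `J` is everything, the vanishing condition is implied by vanishing on the diagonal, for
  -- any `x`.
  have hall : ∀ x : X, IsSumPair F Φ Finset.univ x e e' := fun x =>
    ⟨he, he', fun _ _ => htop _, htop _, fun t ht => absurd (Finset.mem_univ t) ht,
      fun d d' hd _ _ _ hdd _ _ => by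
        rw [← funext fun t => hdd t (Finset.mem_univ t)]
        exact hdiag d hd⟩
  rcases isEmpty_or_nonempty ι with hι | ⟨⟨i⟩⟩
  · exact (hall 0).eq_zero hΦ hc hvan (fun _ => Finset.univ_eq_empty)
  · exact (hall (e i)).eq_zero hΦ hc hvan (fun h => absurd h (he.ne_zero i))

end Uniqueness

section Apartments

variable {F V : Type*} [Field F] [AddCommGroup V] [Module F V]

/-! ### Chains on sequences of subspaces -/

/-- Rational chains on sequences of `k` subspaces of `V`. -/
abbrev SeqChains (F V : Type*) [Field F] [AddCommGroup V] [Module F V] (k : ℕ) : Type _ :=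
  (Fin k → Submodule F V) →₀ ℚ

/-- Append the subspace `K` to a sequence of subspaces. -/
abbrev snocSeq {k : ℕ} (s : Fin k → Submodule F V) (K : Submodule F V) :
    Fin (k + 1) → Submodule F V :=
  Fin.snoc (α := fun _ => Submodule F V) s K

/-- Remove the last member of a sequence of subspaces. -/
abbrev initSeq {k : ℕ} (s : Fin (k + 1) → Submodule F V) : Fin k → Submodule F V :=
  Fin.init (α := fun _ => Submodule F V) s

theorem snocSeq_injective {k : ℕ} (K : Submodule F V) :
    Injective (fun s : Fin k → Submodule F V => snocSeq s K) := fun s s' h => by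
  have := congrArg initSeq h
  simpa using this

/-- Append the subspace `K` to all the sequences in a chain. -/
def snocMap {k : ℕ} (K : Submodule F V) : SeqChains F V k →ₗ[ℚ] SeqChains F V (k + 1) :=
  Finsupp.lmapDomain ℚ ℚ (fun s => snocSeq s K)

theorem snocMap_apply {k : ℕ} (K : Submodule F V) (x : SeqChains F V k)
    (s : Fin (k + 1) → Submodule F V) [Decidable (s (Fin.last k) = K)] :
    snocMap K x s = if s (Fin.last k) = K then x (initSeq s) else 0 := by
  rw [snocMap, Finsupp.lmapDomain_apply]
  split_ifs with h
  · have : s = snocSeq (initSeq s) K := by rw [← h]; exact (Fin.snoc_init_self s).symm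
    conv_lhs => rw [this]
    exact Finsupp.mapDomain_apply (snocSeq_injective K) _ _
  · refine Finsupp.mapDomain_of_notMem_range _ _ ?_
    rintro ⟨s', rfl⟩
    exact h (by simp)

/-- Replace the `i`-th member by `⊥` in all the sequences of a chain. -/
def forget {k : ℕ} (i : Fin k) : SeqChains F V k →ₗ[ℚ] SeqChains F V k :=
  Finsupp.lmapDomain ℚ ℚ (fun s => update s i ⊥)

theorem forget_single {k : ℕ} (i : Fin k) (s : Fin k → Submodule F V) (a : ℚ) :
    forget i (Finsupp.single s a) = Finsupp.single (update s i ⊥) a :=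
  Finsupp.mapDomain_single

theorem snocMap_single {k : ℕ} (K : Submodule F V) (s : Fin k → Submodule F V) (a : ℚ) :
    snocMap K (Finsupp.single s a) = Finsupp.single (snocSeq s K) a :=
  Finsupp.mapDomain_single

theorem forget_castSucc_snocMap {k : ℕ} (i : Fin k) (K : Submodule F V) (x : SeqChains F V k) :
    forget i.castSucc (snocMap K x) = snocMap K (forget i x) := by
  induction x using Finsupp.induction_linear with
  | zero => simp
  | add x y hx hy => simp [hx, hy]
  | single s a =>
    rw [snocMap_single, forget_single, forget_single, snocMap_single, snocSeq, snocSeq,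
      Fin.snoc_update]

theorem forget_last_snocMap {k : ℕ} (K : Submodule F V) (x : SeqChains F V k) :
    forget (Fin.last k) (snocMap K x) = snocMap ⊥ x := by
  induction x using Finsupp.induction_linear with
  | zero => simp
  | add x y hx hy => simp [hx, hy]
  | single s a =>
    rw [snocMap_single, forget_single, snocMap_single, snocSeq, Fin.update_snoc_last]

/-! ### Apartments -/

/-- The apartment class of the vectors `v`, as a chain on sequences of subspaces: the alternating
sum over all orderings of `v` of the sequences of spans of initial segments. -/
def apt : (k : ℕ) → (Fin (k + 1) → V) → SeqChains F V k
  | 0, _ => Finsupp.single default 1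
  | k + 1, v => ∑ j : Fin (k + 2), (-1 : ℚ) ^ (j : ℕ) •
      snocMap (Submodule.span F (Set.range (v ∘ j.succAbove))) (apt k (v ∘ j.succAbove))

theorem sum_succAbove_succAbove {M W : Type*} [AddCommGroup M] [Module ℚ M] {n : ℕ}
    (f : (Fin n → W) → M) (v : Fin (n + 2) → W) :
    ∑ i : Fin (n + 2), (-1 : ℚ) ^ (i : ℕ) • ∑ j : Fin (n + 1), (-1 : ℚ) ^ (j : ℕ) •
      f ((v ∘ i.succAbove) ∘ j.succAbove) = 0 := by
  simp only [Finset.smul_sum, smul_smul]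
  rw [Finset.sum_sigma']
  refine Finset.sum_involution (fun p _ => ⟨p.1.succAbove p.2, p.2.predAbove p.1⟩) ?_ ?_ ?_ ?_
  · rintro ⟨i, j⟩ -
    have hface : (v ∘ (i.succAbove j).succAbove) ∘ (j.predAbove i).succAbove =
        (v ∘ i.succAbove) ∘ j.succAbove :=
      funext fun m => congrArg v (Fin.succAbove_succAbove_succAbove_predAbove i j m)
    have hsign : (-1 : ℚ) ^ ((i.succAbove j : Fin (n + 2)) : ℕ) *
        (-1) ^ ((j.predAbove i : Fin (n + 1)) : ℕ) = -((-1) ^ (i : ℕ) * (-1) ^ (j : ℕ)) := by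
      rw [← pow_add, Fin.neg_one_pow_succAbove_add_predAbove, pow_add]
    simp only [hface, hsign, neg_smul, add_neg_cancel]
  · rintro ⟨i, j⟩ - - h
    exact Fin.succAbove_ne i j (congrArg Sigma.fst h)
  · exact fun _ _ => Finset.mem_univ _
  · rintro ⟨i, j⟩ -
    exact Sigma.ext (Fin.succAbove_succAbove_predAbove i j)
      (heq_of_eq (Fin.predAbove_predAbove_succAbove i j))

/-- Each term of an expanded `apt` depends only on the subfamily left after two deletions, so the
terms cancel in pairs as in `∂ ∘ ∂ = 0`. -/
theorem sum_apt_succAbove {k : ℕ} (v : Fin (k + 2) → V) :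
    ∑ i : Fin (k + 2), (-1 : ℚ) ^ (i : ℕ) • apt (F := F) k (v ∘ i.succAbove) = 0 := by
  cases k with
  | zero => simp [Fin.sum_univ_two, apt]
  | succ k =>
    exact sum_succAbove_succAbove
      (fun w => snocMap (Submodule.span F (Set.range w)) (apt k w)) v

/-- Composing `σ` with the cycles that move `j` and `σ j` to `0` gives a permutation fixing `0`; `τ`
is its restriction to the rest. The two cycles contribute the signs `(-1) ^ j` and `(-1) ^ (σ j)`.
-/
theorem exists_perm_succAbove {n : ℕ} (σ : Equiv.Perm (Fin (n + 1))) (j : Fin (n + 1)) :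
    ∃ τ : Equiv.Perm (Fin n), (∀ t, σ (j.succAbove t) = (σ j).succAbove (τ t)) ∧
      (Equiv.Perm.sign τ : ℤ) =
        Equiv.Perm.sign σ * (-1) ^ (j : ℕ) * (-1) ^ ((σ j : Fin (n + 1)) : ℕ) := by
  set ρ : Equiv.Perm (Fin (n + 1)) := (σ j).cycleRange * σ * j.cycleRange.symm with hρ
  have hρ0 : ρ 0 = 0 := by
    simp [hρ, Equiv.Perm.mul_apply, Fin.cycleRange_symm_zero, Fin.cycleRange_self]
  obtain ⟨⟨p, τ⟩, hτ⟩ := Equiv.Perm.decomposeFin.symm.surjective ρ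
  have hp : p = 0 := by
    rw [← hρ0, ← hτ, Equiv.Perm.decomposeFin_symm_apply_zero]
  subst hp
  refine ⟨τ, fun t => ?_, ?_⟩
  · have h1 : ρ t.succ = (τ t).succ := by
      rw [← hτ, Equiv.Perm.decomposeFin_symm_apply_succ]; simp
    rw [← Fin.cycleRange_symm_succ (σ j), ← h1, ← Fin.cycleRange_symm_succ j]
    simp [hρ, Equiv.Perm.mul_apply]
  · have h2 : Equiv.Perm.sign ρ = Equiv.Perm.sign τ := by
      rw [← hτ, Equiv.Perm.decomposeFin.symm_sign]; simp
    rw [← h2, hρ]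
    simp [Equiv.Perm.sign_mul, Fin.sign_cycleRange]
    ring

theorem apt_comp_perm {k : ℕ} (v : Fin (k + 1) → V) (σ : Equiv.Perm (Fin (k + 1))) :
    apt (F := F) k (v ∘ σ) = (Equiv.Perm.sign σ : ℤ) • apt k v := by
  induction k with
  | zero =>
    have hσ : σ = 1 := Equiv.ext fun _ => Subsingleton.elim (α := Fin 1) _ _
    simp [hσ]
  | succ k ih =>
    rw [apt]
    conv_rhs => rw [apt, ← Equiv.sum_comp σ]
    rw [Finset.smul_sum]
    refine Finset.sum_congr rfl fun j _ => ?_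
    obtain ⟨τ, hτ, hs⟩ := exists_perm_succAbove σ j
    have hv : (v ∘ σ) ∘ j.succAbove = (v ∘ (σ j).succAbove) ∘ τ := funext fun t =>
      congrArg v (hτ t)
    rw [hv, ih, Set.range_comp _ τ, τ.surjective.range_eq, Set.image_univ, map_zsmul, hs,
      ← Int.cast_smul_eq_zsmul ℚ, ← Int.cast_smul_eq_zsmul ℚ, smul_smul, smul_smul]
    congr 1
    push_cast
    have hsq : ((-1 : ℚ) ^ (j : ℕ)) * (-1) ^ (j : ℕ) = 1 := by
      rw [← mul_pow]; simp
    linear_combination ((Equiv.Perm.sign σ : ℤ) : ℚ) * (-1) ^ ((σ j : Fin (k + 2)) : ℕ) * hsq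

theorem apt_congr {k : ℕ} {v v' : Fin (k + 1) → V}
    (h : ∀ i, Submodule.span F {v i} = Submodule.span F {v' i}) : apt (F := F) k v = apt k v' := by
  induction k with
  | zero => rfl
  | succ k ih =>
    rw [apt, apt]
    refine Finset.sum_congr rfl fun j _ => ?_
    rw [ih (v := v ∘ j.succAbove) (v' := v' ∘ j.succAbove) fun i => h (j.succAbove i),
      Submodule.span_range_eq_iSup, Submodule.span_range_eq_iSup]
    simp only [comp_apply, h]

theorem mapDomain_apt {k : ℕ} (g : V →ₗ[F] V) (v : Fin (k + 1) → V) :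
    Finsupp.mapDomain (fun (s : Fin k → Submodule F V) i => (s i).map g) (apt k v) =
      apt k (g ∘ v) := by
  induction k with
  | zero =>
    rw [apt, apt, Finsupp.mapDomain_single]
    exact congrArg (Finsupp.single · 1) (Subsingleton.elim _ _)
  | succ k ih =>
    have hsnoc : ∀ (K : Submodule F V) (x : SeqChains F V k),
        Finsupp.mapDomain (fun (s : Fin (k + 1) → Submodule F V) i => (s i).map g) (snocMap K x) =
          snocMap (K.map g)
            (Finsupp.mapDomain (fun (s : Fin k → Submodule F V) i => (s i).map g) x) := by
      intro K x
      rw [snocMap, snocMap, Finsupp.lmapDomain_apply, Finsupp.lmapDomain_apply,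
        ← Finsupp.mapDomain_comp, ← Finsupp.mapDomain_comp]
      congr 1
      funext s i
      induction i using Fin.lastCases <;> simp
    rw [apt, apt, Finsupp.mapDomain_finsetSum]
    refine Finset.sum_congr rfl fun j _ => ?_
    rw [Finsupp.mapDomain_smul, hsnoc, ih, Submodule.map_span, ← Set.range_comp]
    rfl

/-- Every subfamily with one vector omitted still contains `v 0`, except the one that omits `v 0`;
so only that term can end in a subspace avoiding `v 0`. -/
theorem apt_succ_apply {k : ℕ} (v : Fin (k + 2) → V) (s : Fin (k + 1) → Submodule F V)
    (hs : v 0 ∉ s (Fin.last k))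
    [Decidable (s (Fin.last k) = Submodule.span F (Set.range (v ∘ Fin.succ)))] :
    apt (k + 1) v s = if s (Fin.last k) = Submodule.span F (Set.range (v ∘ Fin.succ)) then
      apt k (v ∘ Fin.succ) (initSeq s) else 0 := by
  classical
  rw [apt, Finsupp.finsetSum_apply, Finset.sum_eq_single 0]
  · rw [Finsupp.smul_apply, snocMap_apply]
    simp only [Fin.succAbove_zero, Fin.val_zero, pow_zero, one_smul]
    congr
  · intro j _ hj
    rw [Finsupp.smul_apply, snocMap_apply, if_neg, smul_zero]
    intro h
    obtain ⟨j, rfl⟩ := Fin.exists_succ_eq.2 hj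
    exact hs (h ▸ Submodule.subset_span ⟨0, by simp⟩)
  · simp

theorem notMem_span_range_succ {k : ℕ} {v : Fin (k + 1) → V} (hv : LinearIndependent F v) :
    v 0 ∉ Submodule.span F (Set.range (v ∘ Fin.succ)) := by
  have := hv.notMem_span_image (s := Set.range Fin.succ) (x := 0) (by simp)
  rwa [← Set.range_comp] at this

theorem apt_ne_zero {k : ℕ} {v : Fin (k + 1) → V} (hv : LinearIndependent F v) :
    apt (F := F) k v ≠ 0 := by
  classical
  induction k with
  | zero => simp [apt]
  | succ k ih =>
    obtain ⟨s, hs⟩ := Finsupp.ne_iff.1 (ih (hv.comp Fin.succ (Fin.succ_injective _)))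
    refine Finsupp.ne_iff.2 ⟨snocSeq s (Submodule.span F (Set.range (v ∘ Fin.succ))), ?_⟩
    rw [apt_succ_apply v _ (by simpa using notMem_span_range_succ hv)]
    simpa using hs

end Apartments

/-! ### Cycles on complete flags and the Solomon–Tits theorem -/

section FlagCycles

variable {F V : Type*} [Field F] [AddCommGroup V] [Module F V]

/-- The sequence `s` is a complete flag of nonzero subspaces in `H`. -/
structure IsCompleteFlag {k : ℕ} (H : Submodule F V) (s : Fin k → Submodule F V) : Prop where
  mono : Monotone s
  finrank_eq : ∀ i, Module.finrank F (s i) = i + 1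
  le : ∀ i, s i ≤ H

theorem IsCompleteFlag.init {k : ℕ} {H : Submodule F V} {s : Fin (k + 1) → Submodule F V}
    (h : IsCompleteFlag H s) : IsCompleteFlag (s (Fin.last k)) (initSeq s) where
  mono _ _ hij := h.mono (Fin.castSucc_le_castSucc_iff.2 hij)
  finrank_eq i := h.finrank_eq i.castSucc
  le _ := h.mono (Fin.le_last _)

theorem IsCompleteFlag.of_init {k : ℕ} {H : Submodule F V} {s : Fin (k + 1) → Submodule F V}
    (h : IsCompleteFlag (s (Fin.last k)) (initSeq s))
    (hs : Module.finrank F (s (Fin.last k)) = k + 1) (hH : s (Fin.last k) ≤ H) :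
    IsCompleteFlag H s where
  mono := by
    intro i j hij
    induction j using Fin.lastCases with
    | last =>
      induction i using Fin.lastCases with
      | last => exact le_rfl
      | cast i => exact h.le i
    | cast j =>
      induction i using Fin.lastCases with
      | last => exact absurd (hij.trans_lt (Fin.castSucc_lt_last j)) (lt_irrefl _)
      | cast i => exact h.mono (Fin.castSucc_le_castSucc_iff.1 hij)
  finrank_eq i := by
    induction i using Fin.lastCases with
    | last => simpa using hs
    | cast i => exact h.finrank_eq i
  le i := by
    induction i using Fin.lastCases with
    | last => exact hH
    | cast i => exact (h.le i).trans hH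

/-- The cycles among the chains on complete flags in `H`. -/
def flagCycles (H : Submodule F V) (k : ℕ) : Submodule ℚ (SeqChains F V k) :=
  Finsupp.supported ℚ ℚ {s | IsCompleteFlag H s} ⊓ ⨅ i, LinearMap.ker (forget i)

theorem mem_flagCycles {H : Submodule F V} {k : ℕ} {z : SeqChains F V k} :
    z ∈ flagCycles H k ↔ (∀ s, z s ≠ 0 → IsCompleteFlag H s) ∧ ∀ i, forget i z = 0 := by
  simp [flagCycles, Finsupp.mem_supported, Set.subset_def]

theorem finrank_span_range_eq {k : ℕ} {v : Fin k → V} (hv : LinearIndependent F v) :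
    Module.finrank F (Submodule.span F (Set.range v)) = k := by
  simpa using finrank_span_eq_card hv

/-- Forgetting the last subspace leaves the alternating sum of `sum_apt_succAbove`; forgetting an
earlier one acts inside the smaller apartments. -/
theorem apt_mem_flagCycles {k : ℕ} {v : Fin (k + 1) → V} (hv : LinearIndependent F v) :
    apt k v ∈ flagCycles (Submodule.span F (Set.range v)) k := by
  classical
  induction k with
  | zero => exact mem_flagCycles.2 ⟨fun s _ => ⟨fun i => i.elim0, fun i => i.elim0,
      fun i => i.elim0⟩, fun i => i.elim0⟩
  | succ k ih =>
    have hsub : ∀ j : Fin (k + 2), LinearIndependent F (v ∘ j.succAbove) := fun j =>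
      hv.comp _ Fin.succAbove_right_injective
    rw [mem_flagCycles]
    refine ⟨fun s hs => ?_, fun i => ?_⟩
    · rw [apt, Finsupp.finsetSum_apply] at hs
      obtain ⟨j, -, hj⟩ := Finset.exists_ne_zero_of_sum_ne_zero hs
      rw [Finsupp.smul_apply, snocMap_apply] at hj
      split_ifs at hj with h
      swap
      · simp at hj
      refine IsCompleteFlag.of_init ?_ (h ▸ finrank_span_range_eq (hsub j))
        (h ▸ Submodule.span_mono (Set.range_comp_subset_range _ _))
      rw [h]
      exact (mem_flagCycles.1 (ih (hsub j))).1 _ (right_ne_zero_of_smul hj)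
    · rw [apt, map_sum]
      simp only [map_smul]
      induction i using Fin.lastCases with
      | last =>
        simp only [forget_last_snocMap]
        simp only [← map_smul, ← map_sum, sum_apt_succAbove, map_zero]
      | cast i =>
        refine Finset.sum_eq_zero fun j _ => ?_
        rw [forget_castSucc_snocMap, (mem_flagCycles.1 (ih (hsub j))).2 i, map_zero, smul_zero]

theorem flagCycles_mono {H H' : Submodule F V} (h : H ≤ H') (k : ℕ) :
    flagCycles H k ≤ flagCycles H' k := fun _ hz =>
  mem_flagCycles.2 ⟨fun s hs =>
    have hc := (mem_flagCycles.1 hz).1 s hs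
    ⟨hc.mono, hc.finrank_eq, fun i => (hc.le i).trans h⟩, (mem_flagCycles.1 hz).2⟩

variable [FiniteDimensional F V]

/-- The apartment class of linearly dependent nonzero vectors has no complete flag in its
support. -/
theorem apt_apply_eq_zero {k : ℕ} {v : Fin (k + 1) → V} (hv0 : ∀ i, v i ≠ 0)
    (hv : ¬ LinearIndependent F v) (s : Fin k → Submodule F V)
    (hs : ∀ i, Module.finrank F (s i) = i + 1) : apt k v s = 0 := by
  classical
  induction k with
  | zero =>
    have : Unique (Fin (0 + 1)) := inferInstanceAs (Unique (Fin 1))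
    exact absurd (linearIndependent_unique_iff.2 (hv0 _)) hv
  | succ k ih =>
    have hlt : Module.finrank F (Submodule.span F (Set.range v)) < k + 2 := by
      refine lt_of_le_of_ne ((finrank_range_le_card (R := F) v).trans (by simp)) fun h => hv ?_
      rw [linearIndependent_iff_card_eq_finrank_span, Fintype.card_fin]
      exact h.symm
    have hinit : ∀ i, Module.finrank F (initSeq s i) = i + 1 := fun i => hs i.castSucc
    -- Dependent subfamilies contribute zero by induction. Independent ones all span the same
    -- subspace as `v`, so the remaining terms share their last subspace and cancel by
    -- `sum_apt_succAbove`.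
    have hterm : ∀ j : Fin (k + 2), ((-1 : ℚ) ^ (j : ℕ) •
        snocMap (Submodule.span F (Set.range (v ∘ j.succAbove))) (apt k (v ∘ j.succAbove))) s =
        if s (Fin.last k) = Submodule.span F (Set.range v) then
          ((-1 : ℚ) ^ (j : ℕ) • apt k (v ∘ j.succAbove)) (initSeq s) else 0 := fun j => by
      rw [Finsupp.smul_apply, snocMap_apply, Finsupp.smul_apply]
      by_cases hj : LinearIndependent F (v ∘ j.succAbove)
      · have : Submodule.span F (Set.range (v ∘ j.succAbove)) = Submodule.span F (Set.range v) :=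
          Submodule.eq_of_le_of_finrank_le (Submodule.span_mono (Set.range_comp_subset_range _ _))
            (by rw [finrank_span_range_eq hj]; omega)
        rw [this]
        split_ifs <;> simp
      · rw [ih (v := v ∘ j.succAbove) (fun i => hv0 _) hj (initSeq s) hinit]
        simp
    rw [apt, Finsupp.finsetSum_apply, Finset.sum_congr rfl fun j _ => hterm j]
    split_ifs
    · rw [← Finsupp.finsetSum_apply, sum_apt_succAbove]; rfl
    · simp

/-- If `s` is in the support, so that `w ∈ s i`, then `s i = p ⊔ span {w}` by dimension, and the
same holds for every flag in the support that differs from `s` only at `i`. So `s` is the only flag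
over its `i`-th face, and the cycle condition at `i` kills its coefficient. -/
theorem mem_flagCycles_apply_eq_zero {k : ℕ} {H : Submodule F V} {z : SeqChains F V k}
    (hz : z ∈ flagCycles H k) {w : V} (i : Fin k)
    (hi : ∀ s, w ∉ s i → z s = 0) (s : Fin k → Submodule F V) (p : Submodule F V)
    (hp : IsCompleteFlag H s → Module.finrank F p = i) (hwp : w ∉ p)
    (hps : ∀ s', IsCompleteFlag H s' → update s' i ⊥ = update s i ⊥ → p ≤ s' i) : z s = 0 := by
  classical
  rw [mem_flagCycles] at hz
  by_contra hs
  have hc := hz.1 s hs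
  have hw0 : w ≠ 0 := by rintro rfl; exact hwp p.zero_mem
  have huniq : ∀ s', z s' ≠ 0 → update s' i ⊥ = update s i ⊥ →
      s' i = p ⊔ Submodule.span F {w} := by
    intro s' hs' he
    have hc' := hz.1 s' hs'
    have hws : w ∈ s' i := by_contra fun h => hs' (hi s' h)
    have hlt : p < p ⊔ Submodule.span F {w} :=
      lt_of_le_of_ne le_sup_left fun h => hwp (h ▸
        Submodule.mem_sup_right (Submodule.mem_span_singleton_self w))
    refine (Submodule.eq_of_le_of_finrank_le (sup_le (hps s' hc' he) ?_) ?_).symm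
    · rwa [Submodule.span_singleton_le_iff_mem]
    · rw [hc'.finrank_eq]
      have := Submodule.finrank_lt_finrank_of_lt hlt
      rw [hp hc] at this
      omega
  have h0 := DFunLike.congr_fun (hz.2 i) (update s i ⊥)
  rw [forget, Finsupp.lmapDomain_apply, Finsupp.mapDomain, Finsupp.sum_apply, Finsupp.sum,
    Finset.sum_eq_single s] at h0
  · exact hs (by simpa using h0)
  · intro s' hs' hne
    rw [Finsupp.single_apply, if_neg]
    intro he
    refine hne (funext fun t => ?_)
    by_cases ht : t = i
    · rw [ht, huniq s' (Finsupp.mem_support_iff.1 hs') he, huniq s hs rfl]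
    · have := congrFun he t
      rwa [update_of_ne ht, update_of_ne ht] at this
  · intro h
    exact absurd (Finsupp.mem_support_iff.2 hs) h

/-- Membership of `w` in the subspaces of flags in the support propagates from the last place down
to the first. There the same argument with `p = ⊥` leaves no flag at all. -/
theorem eq_zero_of_mem_flagCycles {k : ℕ} {H : Submodule F V} {z : SeqChains F V (k + 1)}
    (hz : z ∈ flagCycles H (k + 1)) {w : V} (hw : w ≠ 0)
    (hlast : ∀ s, w ∉ s (Fin.last k) → z s = 0) : z = 0 := by
  have hall : ∀ i : Fin (k + 1), ∀ s, w ∉ s i → z s = 0 := by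
    intro i
    induction i using Fin.reverseInduction with
    | last => exact hlast
    | cast i ih =>
      intro s hs
      refine mem_flagCycles_apply_eq_zero hz i.succ ih s (s i.castSucc) (fun hc => ?_) hs
        fun s' hc' he => ?_
      · rw [hc.finrank_eq]; simp
      · have := congrFun he i.castSucc
        rw [update_of_ne i.castSucc_lt_succ.ne, update_of_ne i.castSucc_lt_succ.ne] at this
        rw [← this]
        exact hc'.mono i.castSucc_lt_succ.le
  ext s
  exact mem_flagCycles_apply_eq_zero hz 0 (hall 0) s ⊥ (fun _ => by simp) (by simpa using hw)
    fun _ _ _ => bot_le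

/-- The part of a chain on those sequences that end with `K`, with `K` removed. -/
def slice {k : ℕ} (K : Submodule F V) : SeqChains F V (k + 1) →ₗ[ℚ] SeqChains F V k :=
  Finsupp.lcomapDomain (fun s => snocSeq s K) (snocSeq_injective K)

omit [FiniteDimensional F V] in
theorem slice_apply {k : ℕ} (K : Submodule F V) (z : SeqChains F V (k + 1))
    (s : Fin k → Submodule F V) : slice K z s = z (snocSeq s K) := rfl

omit [FiniteDimensional F V] in
theorem slice_snoc_single {k : ℕ} (K K' : Submodule F V) (s : Fin k → Submodule F V) (a : ℚ)
    [Decidable (K' = K)] :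
    slice K (Finsupp.single (snocSeq s K') a) = if K' = K then Finsupp.single s a else 0 := by
  classical
  ext s'
  rw [slice_apply, Finsupp.single_apply]
  simp only [Fin.snoc_inj]
  split_ifs <;> simp_all

omit [FiniteDimensional F V] in
theorem slice_forget {k : ℕ} (K : Submodule F V) (i : Fin k) (z : SeqChains F V (k + 1)) :
    slice K (forget i.castSucc z) = forget i (slice K z) := by
  classical
  induction z using Finsupp.induction_linear with
  | zero => simp
  | add x y hx hy => simp [hx, hy]
  | single s a =>
    obtain ⟨s, K', rfl⟩ : ∃ s₀ K', s = snocSeq s₀ K' := ⟨_, _, (Fin.snoc_init_self s).symm⟩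
    rw [forget_single, snocSeq, ← Fin.snoc_update, slice_snoc_single, slice_snoc_single]
    split_ifs
    · rw [forget_single]
    · rw [map_zero]

omit [FiniteDimensional F V] in
theorem slice_mem_flagCycles {k : ℕ} {H : Submodule F V} {z : SeqChains F V (k + 1)}
    (hz : z ∈ flagCycles H (k + 1)) (K : Submodule F V) : slice K z ∈ flagCycles K k := by
  rw [mem_flagCycles] at hz ⊢
  refine ⟨fun s hs => ?_, fun i => ?_⟩
  · simpa using (hz.1 _ hs).init
  · rw [← slice_forget, hz.2, map_zero]

/-- The span of the apartment classes of the bases of `H`. -/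
def aptSpan (H : Submodule F V) (k : ℕ) : Submodule ℚ (SeqChains F V k) :=
  Submodule.span ℚ {x | ∃ v : Fin (k + 1) → V, LinearIndependent F v ∧
    Submodule.span F (Set.range v) = H ∧ apt k v = x}

omit [FiniteDimensional F V] in
theorem aptSpan_le_flagCycles (H : Submodule F V) (k : ℕ) : aptSpan H k ≤ flagCycles H k := by
  rw [aptSpan, Submodule.span_le]
  rintro _ ⟨v, hv, rfl, rfl⟩
  exact apt_mem_flagCycles hv

/-- Adjoin `w` to the bases of `K`. By `apt_succ_apply`, the part of the new apartment that ends in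
subspaces avoiding `w` is the old apartment followed by `K`. -/
theorem exists_cone {k : ℕ} {H K : Submodule F V} (hH : Module.finrank F H = k + 2) (hK : K ≤ H)
    {w : V} (hw : w ∈ H) (hwK : w ∉ K) {x : SeqChains F V k} (hx : x ∈ aptSpan K k) :
    ∃ y ∈ aptSpan H (k + 1), ∀ s, w ∉ s (Fin.last k) → (s (Fin.last k) = K → y s = x (initSeq s)) ∧
      (s (Fin.last k) ≠ K → y s = 0) := by
  classical
  induction hx using Submodule.span_induction with
  | mem x hx =>
    obtain ⟨u, hu, rfl, rfl⟩ := hx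
    have hli : LinearIndependent F (Fin.cons w u : Fin (k + 2) → V) :=
      linearIndependent_finCons.2 ⟨hu, hwK⟩
    refine ⟨apt (k + 1) (Fin.cons w u : Fin (k + 2) → V), Submodule.subset_span
      ⟨_, hli, Submodule.eq_of_le_of_finrank_eq ?_ ?_, rfl⟩, fun s hs => ?_⟩
    · rw [Submodule.span_le]
      rintro _ ⟨i, rfl⟩
      induction i using Fin.cases with
      | zero => exact hw
      | succ i => exact hK (Submodule.subset_span ⟨i, rfl⟩)
    · rw [finrank_span_range_eq hli, hH]
    · have hcomp : (Fin.cons w u : Fin (k + 2) → V) ∘ Fin.succ = u := rfl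
      rw [apt_succ_apply _ s (by simpa using hs), hcomp]
      exact ⟨fun h => if_pos h, fun h => if_neg h⟩
  | zero => exact ⟨0, Submodule.zero_mem _, fun s _ => ⟨fun _ => rfl, fun _ => rfl⟩⟩
  | add x x' _ _ hx hx' =>
    obtain ⟨y, hy, h⟩ := hx
    obtain ⟨y', hy', h'⟩ := hx'
    exact ⟨y + y', Submodule.add_mem _ hy hy', fun s hs =>
      ⟨fun hl => by simp [(h s hs).1 hl, (h' s hs).1 hl],
        fun hl => by simp [(h s hs).2 hl, (h' s hs).2 hl]⟩⟩
  | smul a x _ hx =>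
    obtain ⟨y, hy, h⟩ := hx
    exact ⟨a • y, Submodule.smul_mem _ _ hy, fun s hs =>
      ⟨fun hl => by simp [(h s hs).1 hl], fun hl => by simp [(h s hs).2 hl]⟩⟩

/-- The Solomon–Tits theorem: the top-dimensional cycles of the building are spanned by
apartment classes. -/
theorem flagCycles_le_aptSpan {k : ℕ} {H : Submodule F V} (hH : Module.finrank F H = k + 1) :
    flagCycles H k ≤ aptSpan H k := by
  classical
  have hbot : H ≠ ⊥ := by rintro rfl; simp at hH
  obtain ⟨w, hwH, hw0⟩ := Submodule.exists_mem_ne_zero_of_ne_bot hbot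
  induction k generalizing H w with
  | zero =>
    intro z _
    have hz : z = z (fun i => i.elim0) • apt (F := F) 0 (fun _ : Fin 1 => w) := by
      refine Finsupp.ext fun s => ?_
      rw [apt, Finsupp.smul_single, smul_eq_mul, mul_one, Subsingleton.elim s default,
        Finsupp.single_eq_same]
      exact congrArg z (Subsingleton.elim _ _)
    rw [hz]
    refine Submodule.smul_mem _ _ (Submodule.subset_span ⟨_, ?_, ?_, rfl⟩)
    · exact (linearIndependent_unique_iff (ι := Fin 1) (v := fun _ => w)).2 hw0
    · refine Submodule.eq_of_le_of_finrank_eq ?_ ?_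
      · rw [Submodule.span_le]
        rintro _ ⟨_, rfl⟩
        exact hwH
      · rw [Set.range_const, finrank_span_singleton hw0, hH]
  | succ k ih =>
    intro z hz
    -- For `K` avoiding `w`, the slice of `z` at `K` is a combination of apartments by induction.
    -- Its cone with apex `w` matches `z` on sequences ending with `K`, and vanishes on those ending
    -- with any other subspace that avoids `w`.
    have hex : ∀ K : Submodule F V, ∃ y ∈ aptSpan H (k + 1),
        (∃ s, z s ≠ 0 ∧ s (Fin.last k) = K ∧ w ∉ K) → ∀ s, w ∉ s (Fin.last k) →
          (s (Fin.last k) = K → y s = slice K z (initSeq s)) ∧ (s (Fin.last k) ≠ K → y s = 0) := by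
      intro K
      by_cases hK : ∃ s, z s ≠ 0 ∧ s (Fin.last k) = K ∧ w ∉ K
      · obtain ⟨s, hs, rfl, hwK⟩ := hK
        have hc := (mem_flagCycles.1 hz).1 s hs
        have hfr : Module.finrank F (s (Fin.last k)) = k + 1 := by
          rw [hc.finrank_eq, Fin.val_last]
        have hbot' : s (Fin.last k) ≠ ⊥ := by
          intro h
          rw [h] at hfr
          simp at hfr
        obtain ⟨w', hw', hw0'⟩ := Submodule.exists_mem_ne_zero_of_ne_bot hbot'
        obtain ⟨y, hy, h⟩ := exists_cone hH (hc.le _) hwH hwK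
          (ih hfr hbot' w' hw' hw0' (slice_mem_flagCycles hz (s (Fin.last k))))
        exact ⟨y, hy, fun _ => h⟩
      · exact ⟨0, Submodule.zero_mem _, fun h => absurd h hK⟩
    choose y hy hys using hex
    set T : Finset (Submodule F V) :=
      (z.support.image fun s => s (Fin.last k)).filter (w ∉ ·) with hT
    have hTmem : ∀ K, K ∈ T ↔ ∃ s, z s ≠ 0 ∧ s (Fin.last k) = K ∧ w ∉ K := fun K => by
      simp only [hT, Finset.mem_filter, Finset.mem_image, Finsupp.mem_support_iff]
      exact ⟨fun ⟨⟨s, h1, h2⟩, h3⟩ => ⟨s, h1, h2, h3⟩, fun ⟨s, h1, h2, h3⟩ => ⟨⟨s, h1, h2⟩, h3⟩⟩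
    have hsum : ∑ K ∈ T, y K ∈ aptSpan H (k + 1) := Submodule.sum_mem _ fun K _ => hy K
    -- With the cones subtracted, only flags whose last member contains `w` can survive.
    have hzero : z - ∑ K ∈ T, y K = 0 := by
      refine eq_zero_of_mem_flagCycles
        (Submodule.sub_mem _ hz (aptSpan_le_flagCycles _ _ hsum)) hw0 fun s hs => ?_
      rw [Finsupp.sub_apply, Finsupp.finsetSum_apply, sub_eq_zero]
      by_cases hsT : s (Fin.last k) ∈ T
      · rw [Finset.sum_eq_single_of_mem _ hsT fun K hK hne =>
          (hys K ((hTmem K).1 hK) s hs).2 hne.symm,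
          (hys _ ((hTmem _).1 hsT) s hs).1 rfl, slice_apply]
        exact congrArg z (Fin.snoc_init_self s).symm
      · rw [Finset.sum_eq_zero fun K hK => (hys K ((hTmem K).1 hK) s hs).2 fun h =>
          hsT (h ▸ hK)]
        by_contra h
        exact hsT ((hTmem _).2 ⟨s, h, rfl, hs⟩)
    rw [sub_eq_zero] at hzero
    exact hzero ▸ hsum

end FlagCycles

section Building

variable {F V : Type*} [Field F] [AddCommGroup V] [Module F V]

/-! ### Flags of the building as sequences of subspaces -/

/-- The sequence of subspaces that underlies a flag. -/
def toSeq {k : ℕ} (C : Flag (ProperSubspace F V) k) (i : Fin k) : Submodule F V := (C i).1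

theorem toSeq_injective {k : ℕ} : Injective (toSeq (F := F) (V := V) (k := k)) := fun _ _ h =>
  RelEmbedding.ext fun i => Subtype.ext (congrFun h i)

/-- Chains on flags as chains on sequences of subspaces. -/
def toSeqChains (F V : Type*) [Field F] [AddCommGroup V] [Module F V] (k : ℕ) :
    Chains (ProperSubspace F V) k →ₗ[ℚ] SeqChains F V k :=
  Finsupp.lmapDomain ℚ ℚ toSeq

theorem toSeqChains_single {k : ℕ} (C : Flag (ProperSubspace F V) k) (a : ℚ) :
    toSeqChains F V k (Finsupp.single C a) = Finsupp.single (toSeq C) a :=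
  Finsupp.mapDomain_single

theorem toSeqChains_injective (k : ℕ) : Injective (toSeqChains F V k) :=
  Finsupp.mapDomain_injective toSeq_injective

/-- The part of a chain on sequences of subspaces that is supported on flags. -/
def ofSeqChains (F V : Type*) [Field F] [AddCommGroup V] [Module F V] (k : ℕ) :
    SeqChains F V k →ₗ[ℚ] Chains (ProperSubspace F V) k :=
  Finsupp.lcomapDomain toSeq toSeq_injective

theorem ofSeqChains_toSeqChains {k : ℕ} (z : Chains (ProperSubspace F V) k) :
    ofSeqChains F V k (toSeqChains F V k z) = z :=
  Finsupp.ext fun C => Finsupp.mapDomain_apply toSeq_injective z C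

theorem toSeqChains_ofSeqChains {k : ℕ} {x : SeqChains F V k}
    (hx : ∀ s, x s ≠ 0 → s ∈ Set.range (toSeq (F := F) (V := V) (k := k))) :
    toSeqChains F V k (ofSeqChains F V k x) = x :=
  Finsupp.mapDomain_comapDomain _ toSeq_injective x fun s hs => hx s (by simpa using hs)

variable [FiniteDimensional F V]

theorem finrank_strictMono {k : ℕ} (C : Flag (ProperSubspace F V) k) :
    StrictMono fun i => Module.finrank F (toSeq C i) := fun _ _ hij =>
  Submodule.finrank_lt_finrank_of_lt (C.strictMono hij)

theorem finrank_toSeq_pos {k : ℕ} (C : Flag (ProperSubspace F V) k) (i : Fin k) :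
    0 < Module.finrank F (toSeq C i) := by
  rw [Nat.pos_iff_ne_zero, Ne, Submodule.finrank_eq_zero]
  exact (C i).2.1

theorem finrank_toSeq_lt {k : ℕ} (C : Flag (ProperSubspace F V) k) (i : Fin k) :
    Module.finrank F (toSeq C i) < Module.finrank F V :=
  Submodule.finrank_lt (C i).2.2

/-- The dimensions are `k` strictly increasing numbers between `1` and `k`, which leaves one
possibility. -/
theorem isCompleteFlag_toSeq {k : ℕ} (hk : Module.finrank F V = k + 1)
    (C : Flag (ProperSubspace F V) k) : IsCompleteFlag ⊤ (toSeq C) where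
  mono _ _ hij := C.monotone hij
  le _ := le_top
  finrank_eq i := by
    have hpos := finrank_toSeq_pos C
    have hlt := finrank_toSeq_lt C
    let f : Fin k → Fin k := fun i => ⟨Module.finrank F (toSeq C i) - 1, by
      have := hpos i
      have := hlt i
      omega⟩
    have hf : StrictMono f := fun a b hab => by
      have h1 := finrank_strictMono C hab
      have h2 := hpos a
      simp only [f, Fin.lt_def] at h1 ⊢
      omega
    have hid : f i = i := le_antisymm hf.apply_le (hf.le_apply (x := i))
    have h3 := congrArg Fin.val hid
    have := hpos i
    simp only [f] at h3
    omega

omit [FiniteDimensional F V] in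
theorem IsCompleteFlag.mem_range_toSeq {k : ℕ} (hk : Module.finrank F V = k + 1)
    {s : Fin k → Submodule F V} (hs : IsCompleteFlag ⊤ s) :
    s ∈ Set.range (toSeq (F := F) (V := V) (k := k)) := by
  have hne : ∀ i, s i ≠ ⊥ ∧ s i ≠ ⊤ := fun i => by
    refine ⟨fun h => ?_, fun h => ?_⟩
    · have := hs.finrank_eq i
      rw [h, finrank_bot] at this
      omega
    · have := hs.finrank_eq i
      rw [h, finrank_top, hk] at this
      have := i.2
      omega
  refine ⟨OrderEmbedding.ofStrictMono (fun i => ⟨s i, hne i⟩) fun i j hij => ?_, rfl⟩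
  refine lt_of_le_of_ne (hs.mono hij.le) fun h => ?_
  have h1 := hs.finrank_eq i
  rw [show s i = s j from congrArg Subtype.val h, hs.finrank_eq j] at h1
  exact hij.ne (Fin.ext (by omega))

theorem isEmpty_flag {k : ℕ} (hk : Module.finrank F V = k + 1) :
    IsEmpty (Flag (ProperSubspace F V) (k + 1)) := by
  refine ⟨fun C => ?_⟩
  let f : Fin (k + 1) → Fin k := fun i => ⟨Module.finrank F (toSeq C i) - 1, by
    have := finrank_toSeq_pos C i
    have := finrank_toSeq_lt C i
    omega⟩
  have hf : Injective f := fun a b hab => by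
    refine (finrank_strictMono C).injective ?_
    have h1 := congrArg Fin.val hab
    have h2 := finrank_toSeq_pos C a
    have h3 := finrank_toSeq_pos C b
    simp only [f] at h1 ⊢
    omega
  simpa using Fintype.card_le_of_injective f hf

theorem boundaries_eq_bot {k : ℕ} (hk : Module.finrank F V = k + 1) :
    boundaries (ProperSubspace F V) k = ⊥ := by
  have := isEmpty_flag hk
  rw [boundaries, LinearMap.range_eq_bot]
  exact LinearMap.ext fun x => by rw [Subsingleton.elim x 0, map_zero, map_zero]

omit [FiniteDimensional F V] in
theorem toSeqChains_mapDomain_face {k : ℕ} (i : Fin (k + 1))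
    (z : Chains (ProperSubspace F V) (k + 1)) :
    toSeqChains F V k (Finsupp.mapDomain (Flag.face i) z) =
      Finsupp.mapDomain (fun s t => s (i.succAbove t)) (forget i (toSeqChains F V (k + 1) z)) := by
  rw [toSeqChains, toSeqChains, forget, Finsupp.lmapDomain_apply, Finsupp.lmapDomain_apply,
    Finsupp.lmapDomain_apply, ← Finsupp.mapDomain_comp, ← Finsupp.mapDomain_comp,
    ← Finsupp.mapDomain_comp]
  congr 1
  funext C t
  simp only [comp_apply]
  rw [update_of_ne (Fin.succAbove_ne i t)]
  rfl

/-- Put `⊥` at the place `i` in those flags in which exactly the subspace at the place `i` of a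
complete flag is missing. -/
def insertBot {k : ℕ} (i : Fin (k + 1)) :
    Chains (ProperSubspace F V) k →ₗ[ℚ] SeqChains F V (k + 1) :=
  open scoped Classical in
  Finsupp.linearCombination ℚ fun C =>
    if ∀ t, Module.finrank F (toSeq C t) = i.succAbove t + 1 then
      Finsupp.single (i.insertNth (α := fun _ => Submodule F V) ⊥ (toSeq C)) 1 else 0

/-- The faces of a complete flag at different places have different dimension sequences, so
`insertBot i` isolates the `i`-th term of the boundary. -/
theorem insertBot_boundary {k : ℕ} (hk : Module.finrank F V = k + 2) (i : Fin (k + 1))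
    (z : Chains (ProperSubspace F V) (k + 1)) :
    insertBot i (boundary _ k z) = (-1 : ℚ) ^ (i : ℕ) • forget i (toSeqChains F V (k + 1) z) := by
  classical
  induction z using Finsupp.induction_linear with
  | zero => simp
  | add x y hx hy => simp [hx, hy]
  | single C a =>
    have hface : ∀ j t, Module.finrank F (toSeq (C.face j) t) = j.succAbove t + 1 := fun j t =>
      (isCompleteFlag_toSeq hk C).finrank_eq (j.succAbove t)
    rw [boundary_single, map_sum, Finset.sum_eq_single i]
    · rw [map_smul, insertBot, Finsupp.linearCombination_single, if_pos (hface i),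
        toSeqChains_single, forget_single, Finsupp.smul_single, smul_eq_mul, mul_one]
      congr 2
      exact Fin.insertNth_removeNth i (⊥ : Submodule F V) (toSeq C)
    · intro j _ hj
      rw [map_smul, insertBot, Finsupp.linearCombination_single, if_neg, smul_zero, smul_zero]
      intro h
      refine hj (Fin.succAbove_left_injective (funext fun t => Fin.ext ?_))
      have := (hface j t).symm.trans (h t)
      omega
    · simp

/-- The point is that a vanishing alternating sum of faces forces each kind of face to vanish
separately. -/
theorem mem_cycles_iff {k : ℕ} (hk : Module.finrank F V = k + 1)
    (z : Chains (ProperSubspace F V) k) :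
    z ∈ cycles (ProperSubspace F V) k ↔ toSeqChains F V k z ∈ flagCycles ⊤ k := by
  have hsupp : ∀ s, toSeqChains F V k z s ≠ 0 → IsCompleteFlag ⊤ s := fun s hs => by
    have : s ∈ Set.range (toSeq (F := F) (V := V) (k := k)) := by
      by_contra h
      exact hs (Finsupp.mapDomain_of_notMem_range _ _ h)
    obtain ⟨C, rfl⟩ := this
    exact isCompleteFlag_toSeq hk C
  rw [mem_flagCycles, and_iff_right hsupp]
  cases k with
  | zero => exact ⟨fun _ i => i.elim0, fun _ => Submodule.mem_top⟩
  | succ k =>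
    constructor
    · intro hz i
      have h := insertBot_boundary hk i z
      rw [show boundary _ k z = 0 from hz, map_zero] at h
      exact (smul_eq_zero.1 h.symm).resolve_left (pow_ne_zero _ (by norm_num))
    · intro h
      change boundary _ k z = 0
      rw [boundary, LinearMap.sum_apply]
      refine Finset.sum_eq_zero fun i _ => ?_
      rw [LinearMap.smul_apply, Finsupp.lmapDomain_apply]
      have h0 : toSeqChains F V k (Finsupp.mapDomain (Flag.face i) z) = 0 := by
        rw [toSeqChains_mapDomain_face, h i, Finsupp.mapDomain_zero]
      rw [(map_eq_zero_iff _ (toSeqChains_injective k)).1 h0, smul_zero]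

/-! ### Apartment classes in the Steinberg module -/

omit [FiniteDimensional F V] in
theorem toSeqChains_ofSeqChains_apt {k : ℕ} (hk : Module.finrank F V = k + 1)
    {v : Fin (k + 1) → V} (hv : LinearIndependent F v) :
    toSeqChains F V k (ofSeqChains F V k (apt k v)) = apt k v :=
  toSeqChains_ofSeqChains fun _ hs => (((mem_flagCycles.1
    (flagCycles_mono le_top k (apt_mem_flagCycles hv))).1 _ hs).mem_range_toSeq hk)

theorem ofSeqChains_apt_mem_cycles {k : ℕ} (hk : Module.finrank F V = k + 1)
    {v : Fin (k + 1) → V} (hv : LinearIndependent F v) :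
    ofSeqChains F V k (apt k v) ∈ cycles (ProperSubspace F V) k := by
  rw [mem_cycles_iff hk, toSeqChains_ofSeqChains_apt hk hv]
  exact flagCycles_mono le_top k (apt_mem_flagCycles hv)

/-- The apartment cycle of a basis `v`; zero if `v` is not a basis. -/
def aptCycle {k : ℕ} (hk : Module.finrank F V = k + 1) (v : Fin (k + 1) → V) :
    cycles (ProperSubspace F V) k :=
  open scoped Classical in
  if hv : LinearIndependent F v then ⟨_, ofSeqChains_apt_mem_cycles hk hv⟩ else 0

theorem coe_aptCycle {k : ℕ} (hk : Module.finrank F V = k + 1) {v : Fin (k + 1) → V}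
    (hv : LinearIndependent F v) :
    (aptCycle hk v : Chains (ProperSubspace F V) k) = ofSeqChains F V k (apt k v) := by
  rw [aptCycle, dif_pos hv]

theorem mem_span_aptCycle {k : ℕ} (hk : Module.finrank F V = k + 1)
    (z : cycles (ProperSubspace F V) k) :
    z ∈ Submodule.span ℚ (aptCycle hk '' {v | LinearIndependent F v}) := by
  have key : ∀ x ∈ aptSpan (⊤ : Submodule F V) k,
      ∃ c ∈ Submodule.span ℚ (aptCycle hk '' {v | LinearIndependent F v}),
        (c : Chains (ProperSubspace F V) k) = ofSeqChains F V k x := by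
    intro x hx
    induction hx using Submodule.span_induction with
    | mem x hx =>
      obtain ⟨v, hv, -, rfl⟩ := hx
      exact ⟨aptCycle hk v, Submodule.subset_span ⟨v, hv, rfl⟩, coe_aptCycle hk hv⟩
    | zero => exact ⟨0, Submodule.zero_mem _, by simp⟩
    | add x y _ _ hx hy =>
      obtain ⟨c, hc, hcx⟩ := hx
      obtain ⟨d, hd, hdy⟩ := hy
      exact ⟨c + d, Submodule.add_mem _ hc hd, by simp [hcx, hdy]⟩
    | smul a x _ hx =>
      obtain ⟨c, hc, hcx⟩ := hx
      exact ⟨a • c, Submodule.smul_mem _ _ hc, by simp [hcx]⟩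
  obtain ⟨c, hc, hcz⟩ := key _ (flagCycles_le_aptSpan (by rw [finrank_top, hk])
    ((mem_cycles_iff hk _).1 z.2))
  rw [ofSeqChains_toSeqChains] at hcz
  rwa [← Subtype.ext hcz]

-- This is `sum_apt_succAbove` for the family `x, v 0, …, v k`. Moving `x` from the front to the
-- place `j` costs a cycle of sign `(-1) ^ j`.
omit [FiniteDimensional F V] in
theorem apt_eq_sum_update {k : ℕ} (v : Fin (k + 1) → V) (x : V) :
    apt (F := F) k v = ∑ j, apt k (update v j x) := by
  have h := sum_apt_succAbove (F := F) (Fin.cons x v : Fin (k + 2) → V)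
  have hcomp : ∀ j : Fin (k + 1), (Fin.cons x v : Fin (k + 2) → V) ∘ j.succ.succAbove =
      update v j x ∘ j.cycleRange.symm := fun j => by
    funext t
    induction t using Fin.cases with
    | zero => simp [Fin.cycleRange_symm_zero]
    | succ t => simp [Fin.cycleRange_symm_succ, Fin.succAbove_ne]
  rw [Fin.sum_univ_succ] at h
  simp only [hcomp, apt_comp_perm] at h
  have h0 : (Fin.cons x v : Fin (k + 2) → V) ∘ (0 : Fin (k + 2)).succAbove = v := by
    funext t; simp
  rw [h0, Fin.val_zero, pow_zero, one_smul, add_eq_zero_iff_eq_neg, ← Finset.sum_neg_distrib] at h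
  rw [h]
  refine Finset.sum_congr rfl fun j _ => ?_
  rw [Equiv.Perm.sign_symm, Fin.sign_cycleRange, ← Int.cast_smul_eq_zsmul ℚ, smul_smul,
    Fin.val_succ, pow_succ]
  have hsq : ((-1 : ℚ) ^ (j : ℕ)) * (-1) ^ (j : ℕ) = 1 := by
    rw [← mul_pow]; simp
  push_cast
  rw [show (-1 : ℚ) ^ (j : ℕ) * -1 * (-1) ^ (j : ℕ) = -1 by linear_combination -hsq]
  simp

theorem isModularSymbol_aptCycle {k : ℕ} (hk : Module.finrank F V = k + 1) :
    IsModularSymbol F (aptCycle hk) where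
  smul v hv a ha := by
    have hc : Fintype.card (Fin (k + 1)) = Module.finrank F V := by rw [hk, Fintype.card_fin]
    refine Subtype.ext ?_
    rw [coe_aptCycle hk (linearIndependent_smul_of_ne_zero hc hv ha), coe_aptCycle hk hv]
    congr 1
    exact apt_congr fun i => Submodule.span_singleton_smul_eq (isUnit_iff_ne_zero.2 (ha i)) _
  perm v hv σ := by
    refine Subtype.ext ?_
    change _ = (cycles (ProperSubspace F V) k).subtype ((Equiv.Perm.sign σ : ℤ) • aptCycle hk v)
    rw [map_zsmul, Submodule.subtype_apply, coe_aptCycle hk (hv.comp _ σ.injective), coe_aptCycle hk hv,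
      apt_comp_perm, map_zsmul]
  rel v hv J c x hJ hc hx := by
    have hcard : Fintype.card (Fin (k + 1)) = Module.finrank F V := by rw [hk, Fintype.card_fin]
    have hli : ∀ i ∈ J, LinearIndependent F (update v i x) := fun i hi =>
      linearIndependent_update hcard hv hx hi (hc i hi)
    have hx0 : x ≠ 0 := by
      obtain ⟨i, hi⟩ := hJ
      simpa using (hli i hi).ne_zero i
    refine Subtype.ext ?_
    rw [coe_aptCycle hk hv, AddSubmonoidClass.coe_finsetSum,
      Finset.sum_congr rfl fun i hi => coe_aptCycle hk (hli i hi), apt_eq_sum_update v x, map_sum]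
    -- For `i` outside `J` the vector `x` lies in the span of the remaining members, so the family
    -- is dependent and its apartment vanishes on complete flags.
    refine (Finset.sum_subset (Finset.subset_univ J) fun i _ hi => ?_).symm
    refine Finsupp.ext fun C => ?_
    refine apt_apply_eq_zero (fun t => ?_) (fun h => ?_) _ (isCompleteFlag_toSeq hk C).finrank_eq
    · by_cases hti : t = i
      · simpa [hti] using hx0
      · simpa [hti] using hv.ne_zero t
    · refine h.notMem_span_image (s := J) (x := i) (by simpa using hi) ?_
      have hmem : ∑ t ∈ J, c t • v t ∈ Submodule.span F (update v i x '' J) :=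
        Submodule.sum_mem _ fun t ht => Submodule.smul_mem _ _ (Submodule.subset_span
          ⟨t, ht, update_of_ne (by rintro rfl; exact hi ht) _ _⟩)
      rw [← hx] at hmem
      simpa only [update_self] using hmem

theorem aptCycle_ne_zero {k : ℕ} (hk : Module.finrank F V = k + 1) {v : Fin (k + 1) → V}
    (hv : LinearIndependent F v) : (aptCycle hk v : Chains (ProperSubspace F V) k) ≠ 0 := by
  intro h
  have h1 := toSeqChains_ofSeqChains_apt hk hv
  rw [← coe_aptCycle hk hv, h, map_zero] at h1
  exact apt_ne_zero hv h1.symm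

theorem chainsMap_aptCycle {k : ℕ} (hk : Module.finrank F V = k + 1) {v : Fin (k + 1) → V}
    (hv : LinearIndependent F v) (g : LinearMap.GeneralLinearGroup F V) :
    chainsMap (subspaceMap g) k (aptCycle hk v : Chains (ProperSubspace F V) k) =
      aptCycle hk (LinearMap.GeneralLinearGroup.toLinearEquiv g ∘ v) := by
  have hgv : LinearIndependent F (LinearMap.GeneralLinearGroup.toLinearEquiv g ∘ v) :=
    hv.map' (LinearMap.GeneralLinearGroup.toLinearEquiv g : V →ₗ[F] V) (LinearEquiv.ker _)
  have hcomm : ∀ x : Chains (ProperSubspace F V) k,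
      toSeqChains F V k (chainsMap (subspaceMap g) k x) =
        Finsupp.mapDomain (fun (s : Fin k → Submodule F V) i =>
          (s i).map (LinearMap.GeneralLinearGroup.toLinearEquiv g : V →ₗ[F] V))
            (toSeqChains F V k x) := fun x => by
    rw [toSeqChains, chainsMap, Finsupp.lmapDomain_apply, Finsupp.lmapDomain_apply,
      Finsupp.lmapDomain_apply, ← Finsupp.mapDomain_comp, ← Finsupp.mapDomain_comp]
    rfl
  refine toSeqChains_injective k ?_
  rw [hcomm, coe_aptCycle hk hv, coe_aptCycle hk hgv, toSeqChains_ofSeqChains_apt hk hv,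
    toSeqChains_ofSeqChains_apt hk hgv, mapDomain_apt]
  rfl

end Building

open scoped TensorProduct

/-! ### The positive definite form on chains -/

section InnerProduct

variable {P : Type*} [PartialOrder P]

/-- The bilinear form on chains for which the flags are orthonormal. -/
def flagForm (P : Type*) [PartialOrder P] (k : ℕ) : Chains P k →ₗ[ℚ] Chains P k →ₗ[ℚ] ℚ :=
  Finsupp.linearCombination ℚ fun C => Finsupp.lapply C

theorem flagForm_single {k : ℕ} (C : Flag P k) (a : ℚ) (y : Chains P k) :
    flagForm P k (Finsupp.single C a) y = a * y C := by
  simp [flagForm]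

theorem flagForm_chainsMap {k : ℕ} (e : P ↪o P) (x y : Chains P k) :
    flagForm P k (chainsMap e k x) (chainsMap e k y) = flagForm P k x y := by
  have hinj : Injective (Flag.map e : Flag P k → Flag P k) := fun C C' h =>
    RelEmbedding.ext fun i => e.injective (DFunLike.congr_fun h i)
  induction x using Finsupp.induction_linear with
  | zero => simp
  | add x x' hx hx' => simp [hx, hx']
  | single C a =>
    rw [chainsMap_single, flagForm_single, flagForm_single, chainsMap, Finsupp.lmapDomain_apply,
      Finsupp.mapDomain_apply hinj]

theorem flagForm_self_ne_zero {k : ℕ} {x : Chains P k} (hx : x ≠ 0) : flagForm P k x x ≠ 0 := by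
  have h : flagForm P k x x = ∑ C ∈ x.support, x C * x C := by
    simp [flagForm, Finsupp.linearCombination_apply, Finsupp.sum, LinearMap.sum_apply]
  rw [h]
  refine (Finset.sum_pos (fun C hC => ?_) (Finsupp.support_nonempty_iff.2 hx)).ne'
  exact mul_self_pos.2 (Finsupp.mem_support_iff.1 hC)

end InnerProduct

/-! ### The coinvariants of the tensor square -/

section Coinvariants

variable {F V : Type*} [Field F] [AddCommGroup V] [Module F V] [FiniteDimensional F V]

theorem IsModularSymbol.map {F X C D ι : Type*} [Field F] [AddCommGroup X] [Module F X]
    [AddCommGroup C] [AddCommGroup D] [Fintype ι] [DecidableEq ι] {φ : (ι → X) → C}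
    (hφ : IsModularSymbol F φ) (f : C →+ D) : IsModularSymbol F fun v => f (φ v) where
  smul v hv a ha := congrArg f (hφ.smul v hv a ha)
  perm v hv σ := by rw [hφ.perm v hv, map_zsmul]
  rel v hv J c x hJ hc hx := by rw [hφ.rel v hv J c x hJ hc hx, map_sum]

/-- The apartment class of a basis in the top homology of the building. -/
def aptClass {k : ℕ} (hk : Module.finrank F V = k + 1) (v : Fin (k + 1) → V) :
    ReducedHomology (ProperSubspace F V) k :=
  Submodule.mkQ _ (aptCycle hk v)

theorem isModularSymbol_aptClass {k : ℕ} (hk : Module.finrank F V = k + 1) :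
    IsModularSymbol F (aptClass (F := F) (V := V) hk) :=
  (isModularSymbol_aptCycle hk).map
    (Submodule.mkQ ((boundaries (ProperSubspace F V) k).comap
      (cycles (ProperSubspace F V) k).subtype)).toAddMonoidHom

theorem span_aptClass {k : ℕ} (hk : Module.finrank F V = k + 1) :
    Submodule.span ℚ (aptClass hk '' {v | LinearIndependent F v}) =
      (⊤ : Submodule ℚ (ReducedHomology (ProperSubspace F V) k)) := by
  rw [eq_top_iff]
  rintro x -
  obtain ⟨z, rfl⟩ := Submodule.mkQ_surjective _ x
  have h := Submodule.mem_map_of_mem (f := Submodule.mkQ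
    ((boundaries (ProperSubspace F V) k).comap (cycles (ProperSubspace F V) k).subtype))
    (mem_span_aptCycle hk z)
  rw [Submodule.map_span, ← Set.image_comp] at h
  exact h

theorem homologyMap_aptClass {k : ℕ} (hk : Module.finrank F V = k + 1) {v : Fin (k + 1) → V}
    (hv : LinearIndependent F v) (g : LinearMap.GeneralLinearGroup F V) :
    homologyMap (subspaceMap g) k (aptClass hk v) =
      aptClass hk (LinearMap.GeneralLinearGroup.toLinearEquiv g ∘ v) :=
  congrArg (Submodule.mkQ _) (Subtype.ext (chainsMap_aptCycle hk hv g))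

/-- The cycle that represents a class in the top homology of the building. -/
def topCycle {k : ℕ} (hk : Module.finrank F V = k + 1) :
    ReducedHomology (ProperSubspace F V) k →ₗ[ℚ] Chains (ProperSubspace F V) k :=
  Submodule.liftQ _ (cycles (ProperSubspace F V) k).subtype (by
    rw [boundaries_eq_bot hk]
    exact le_rfl)

theorem topCycle_homologyMap {k : ℕ} (hk : Module.finrank F V = k + 1)
    (g : LinearMap.GeneralLinearGroup F V) (x : ReducedHomology (ProperSubspace F V) k) :
    topCycle hk (homologyMap (subspaceMap g) k x) = chainsMap (subspaceMap g) k (topCycle hk x) := by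
  obtain ⟨z, rfl⟩ := Submodule.mkQ_surjective _ x
  rfl

theorem finrank_eq_sub_one_add_one (F V : Type*) [Field F] [AddCommGroup V] [Module F V]
    [FiniteDimensional F V] [Nontrivial V] :
    Module.finrank F V = (Module.finrank F V - 1) + 1 :=
  (Nat.sub_add_cancel Module.finrank_pos).symm

variable [Nontrivial V]

/-- The invariant pairing on the Steinberg module. -/
def stPairing (F V : Type*) [Field F] [AddCommGroup V] [Module F V] [FiniteDimensional F V]
    [Nontrivial V] : (stSquareRep F V).Coinvariants →ₗ[ℚ] ℚ :=
  Representation.Coinvariants.lift _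
    (TensorProduct.lift ((flagForm (ProperSubspace F V) _).compl₁₂
      (topCycle (finrank_eq_sub_one_add_one F V)) (topCycle (finrank_eq_sub_one_add_one F V))))
    fun g => TensorProduct.ext' fun x y => by
      change flagForm _ _ (topCycle _ (homologyMap _ _ x)) (topCycle _ (homologyMap _ _ y)) =
        flagForm _ _ (topCycle _ x) (topCycle _ y)
      rw [topCycle_homologyMap, topCycle_homologyMap, flagForm_chainsMap]

/-- The class of a tensor product of two apartment classes in the coinvariants. -/
def aptPair (e e' : Fin (Module.finrank F V - 1 + 1) → V) : (stSquareRep F V).Coinvariants :=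
  Representation.Coinvariants.mk (stSquareRep F V)
    (aptClass (finrank_eq_sub_one_add_one F V) e ⊗ₜ[ℚ] aptClass (finrank_eq_sub_one_add_one F V) e')

theorem stPairing_aptPair_self_ne_zero {v : Fin (Module.finrank F V - 1 + 1) → V}
    (hv : LinearIndependent F v) : stPairing F V (aptPair v v) ≠ 0 :=
  flagForm_self_ne_zero (aptCycle_ne_zero (finrank_eq_sub_one_add_one F V) hv)

theorem isInvariantForm_aptPair : IsInvariantForm F (aptPair (F := F) (V := V)) where
  left e' _ := (isModularSymbol_aptClass (finrank_eq_sub_one_add_one F V)).map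
    (Representation.Coinvariants.mk (stSquareRep F V) ∘ₗ
      (TensorProduct.mk ℚ (St F V) (St F V)).flip
        (aptClass (finrank_eq_sub_one_add_one F V) e')).toAddMonoidHom
  right e _ := (isModularSymbol_aptClass (finrank_eq_sub_one_add_one F V)).map
    (Representation.Coinvariants.mk (stSquareRep F V) ∘ₗ
      TensorProduct.mk ℚ (St F V) (St F V)
        (aptClass (finrank_eq_sub_one_add_one F V) e)).toAddMonoidHom
  inv g e e' he he' := by
    have hk := finrank_eq_sub_one_add_one F V
    have h := Representation.Coinvariants.mk_self_apply (stSquareRep F V)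
      (LinearMap.GeneralLinearGroup.ofLinearEquiv g) (aptClass hk e ⊗ₜ[ℚ] aptClass hk e')
    have hact : stSquareRep F V (LinearMap.GeneralLinearGroup.ofLinearEquiv g)
        (aptClass hk e ⊗ₜ[ℚ] aptClass hk e') = aptClass hk (g ∘ e) ⊗ₜ[ℚ] aptClass hk (g ∘ e') :=
      congrArg₂ (· ⊗ₜ[ℚ] ·) (homologyMap_aptClass hk he _) (homologyMap_aptClass hk he' _)
    rw [hact] at h
    exact h

theorem IsInvariantForm.map {F X C D ι : Type*} [Field F] [AddCommGroup X] [Module F X]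
    [AddCommGroup C] [AddCommGroup D] [Fintype ι] [DecidableEq ι] {Φ : (ι → X) → (ι → X) → C}
    (hΦ : IsInvariantForm F Φ) (f : C →+ D) : IsInvariantForm F fun e e' => f (Φ e e') where
  left e' he' := (hΦ.left e' he').map f
  right e he := (hΦ.right e he).map f
  inv g e e' he he' := congrArg f (hΦ.inv g e e' he he')

/-- The general linear group is transitive on bases. -/
theorem IsInvariantForm.diagonal_eq {F X C ι : Type*} [Field F] [AddCommGroup X] [Module F X]
    [FiniteDimensional F X] [AddCommGroup C] [Fintype ι] [DecidableEq ι] [Nonempty ι]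
    {Φ : (ι → X) → (ι → X) → C}
    (hΦ : IsInvariantForm F Φ) (hc : Fintype.card ι = Module.finrank F X) {b b' : ι → X}
    (hb : LinearIndependent F b) (hb' : LinearIndependent F b') : Φ b' b' = Φ b b := by
  let B := basisOfLinearIndependentOfCardEqFinrank hb hc
  let B' := basisOfLinearIndependentOfCardEqFinrank hb' hc
  have h : B.equiv B' (Equiv.refl ι) ∘ b = b' := funext fun t => by
    have := B.equiv_apply t B' (Equiv.refl ι)
    simpa [B, B'] using this
  rw [← hΦ.inv (B.equiv B' (Equiv.refl ι)) b b hb hb, h]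

/-- In the quotient by the line of `aptPair b b`, the form `aptPair` vanishes on the diagonal, hence
everywhere by `IsInvariantForm.eq_zero`. As apartment classes span both tensor factors, the quotient
is zero. -/
theorem span_aptPair_eq_top {b : Fin (Module.finrank F V - 1 + 1) → V}
    (hb : LinearIndependent F b) : Submodule.span ℚ {aptPair b b} = ⊤ := by
  have hk := finrank_eq_sub_one_add_one F V
  have hc : Fintype.card (Fin (Module.finrank F V - 1 + 1)) = Module.finrank F V := by
    rw [Fintype.card_fin, ← hk]
  set D := Submodule.span ℚ {aptPair (F := F) b b} with hD
  have hform := (isInvariantForm_aptPair (F := F) (V := V)).map D.mkQ.toAddMonoidHom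
  have hzero : ∀ e e', LinearIndependent F e → LinearIndependent F e' →
      D.mkQ (aptPair e e') = 0 := by
    refine hform.eq_zero _ hc rfl fun b' hb' => ?_
    rw [isInvariantForm_aptPair.diagonal_eq hc hb hb']
    exact (Submodule.Quotient.mk_eq_zero _).2 (Submodule.mem_span_singleton_self _)
  let β : St F V →ₗ[ℚ] St F V →ₗ[ℚ] (stSquareRep F V).Coinvariants ⧸ D :=
    (TensorProduct.mk ℚ (St F V) (St F V)).compr₂
      (D.mkQ ∘ₗ Representation.Coinvariants.mk (stSquareRep F V))
  have hβ : β = 0 := by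
    refine LinearMap.ext_on (span_aptClass hk) ?_
    rintro _ ⟨e, he, rfl⟩
    refine LinearMap.ext_on (span_aptClass hk) ?_
    rintro _ ⟨e', he', rfl⟩
    exact hzero e e' he he'
  have hmk : D.mkQ ∘ₗ Representation.Coinvariants.mk (stSquareRep F V) = 0 :=
    TensorProduct.ext' fun x y => LinearMap.congr_fun (LinearMap.congr_fun hβ x) y
  rw [eq_top_iff]
  rintro x -
  obtain ⟨t, rfl⟩ := Representation.Coinvariants.mk_surjective _ x
  exact (Submodule.Quotient.mk_eq_zero _).1 (LinearMap.congr_fun hmk t)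

end Coinvariants

end SteinbergModule

end

theorem mainTheorem4 (F V : Type*) [Field F] [AddCommGroup V] [Module F V]
    [FiniteDimensional F V] [Nontrivial V] :
    Nonempty ((SteinbergModule.stSquareRep F V).Coinvariants ≃ₗ[ℚ] ℚ) := by
  have hk := SteinbergModule.finrank_eq_sub_one_add_one F V
  let b := Module.finBasisOfFinrankEq F V hk
  have hb := b.linearIndependent
  have hne := SteinbergModule.stPairing_aptPair_self_ne_zero hb
  refine ⟨LinearEquiv.ofBijective (SteinbergModule.stPairing F V) ⟨?_, ?_⟩⟩
  -- The coinvariants are spanned by `aptPair b b`, on which the pairing is nonzero.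
  · rw [← LinearMap.ker_eq_bot, LinearMap.ker_eq_bot']
    intro x hx
    have hmem : x ∈ Submodule.span ℚ {SteinbergModule.aptPair (F := F) b b} := by
      rw [SteinbergModule.span_aptPair_eq_top hb]
      trivial
    obtain ⟨a, rfl⟩ := Submodule.mem_span_singleton.1 hmem
    rw [map_smul, smul_eq_mul, mul_eq_zero, or_iff_left hne] at hx
    rw [hx, zero_smul]
  · exact LinearMap.surjective fun h => hne (by rw [h, LinearMap.zero_apply])
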